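/- Let $\Gamma$ be a finite simplicial graph and let $A_\Gamma=\langle v\in V(\Gamma)\mid [v,w]=1 \text{ for every edge } vw\rangle$ be its right-angled Artin group. Let $(\Gamma_1,\Gamma_2,\Gamma_3)$ be a splitting of $\Gamma$, i.e. $\Gamma_1,\Gamma_2,\Gamma_3$ are pairwise distinct non-empty full subgraphs of $\Gamma$ such that $\Gamma=\Gamma_1\cup\Gamma_2$ and $\Gamma_3=\Gamma_1\cap\Gamma_2$ (both on vertices and on edges). Let $f:A_\Gamma\to\mathbb R$ be a discrete character, i.e. a homomorphism whose image is infinite cyclic. For $k=1,2,3$ let $f_k:A_{\Gamma_k}\to\mathbb R$ be the restriction of $f$, and let $I_{\Gamma,\Gamma_k}=[f(A_\Gamma):f(A_{\Gamma_k})]\in\mathbb N\cup\{\infty\}$. Then $A_\Gamma$ is the amalgamated product $A_{\Gamma_1}*_{A_{\Gamma_3}}A_{\Gamma_2}$. Its Bass–Serre graph, whose vertices are the left cosets of $A_{\Gamma_1}$ and of $A_{\Gamma_2}$ and whose edges are the left cosets of $A_{\Gamma_3}$, the edge $gA_{\Gamma_3}$ joining $gA_{\Gamma_1}$ to $gA_{\Gamma_2}$,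 is a tree. Let $\mathcal G$ be the quotient graph of groups of the action of $\ker f$ on this tree by left multiplication: its underlying graph is the quotient graph, and its vertex and edge groups are the stabilizers in $\ker f$ of representatives of the orbits. Then $\ker f$ splits as the graph of groups $\mathcal G$, i.e. the underlying graph of $\mathcal G$ is connected and $\ker f$ is isomorphic to the fundamental group of $\mathcal G$ (at any base vertex). Moreover: - the vertex set of $\mathcal G$ is a disjoint union $V_1\sqcup V_2$, where for $k=1,2$ the set $V_k$ has $I_{\Gamma,\Gamma_k}$ elements and the group of every vertex in $V_k$ is isomorphic to $\ker(f_k)$; - $\mathcal G$ has $I_{\Gamma,\Gamma_3}$ (unoriented) edges, and the group of every edge is isomorphic to $\ker(f_3)$. In particular: 1. if $f_3\neq 0$, then the underlying graph of $\mathcal G$ is finite, so $\ker f$ splits as a finite graph of groups; 2. if $f_3=0$, then $\ker f$ surjects onto $\mathbb F_\infty$, the free group of countably infinite rank. -/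

import Mathlib

universe u

/-! ### Right-angled Artin groups -/

/-- The right-angled Artin group of a graph `Γ`: generated by the vertices, with the relations
saying that adjacent vertices commute. -/
abbrev RAAG {V : Type u} (Γ : SimpleGraph V) : Type u :=
  PresentedGroup {r : FreeGroup V | ∃ v w, Γ.Adj v w ∧
    r = FreeGroup.of v * FreeGroup.of w * (FreeGroup.of v)⁻¹ * (FreeGroup.of w)⁻¹}

/-- The homomorphism of right-angled Artin groups induced by a map of graphs, sending the
generator `v` to the generator `φ v`. -/
def RAAG.map {V W : Type u} {Γ : SimpleGraph V} {Δ : SimpleGraph W} (φ : Γ →g Δ) :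
    RAAG Γ →* RAAG Δ :=
  PresentedGroup.toGroup (f := fun v => PresentedGroup.of (φ v)) (by
    rintro r ⟨v, w, h, rfl⟩
    simp only [map_mul, map_inv, FreeGroup.lift_apply_of]
    exact PresentedGroup.one_of_mem ⟨φ v, φ w, φ.map_adj h, rfl⟩)

/-- The natural map `A_Λ → A_Γ` for a subgraph `Λ` of `Γ`. -/
def RAAG.incl {V : Type u} {Γ : SimpleGraph V} (Λ : Γ.Subgraph) : RAAG Λ.coe →* RAAG Γ :=
  RAAG.map Λ.hom

/-- The subgroup of `A_Γ` which is the image of `A_Λ`. -/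
def RAAG.sub {V : Type u} {Γ : SimpleGraph V} (Λ : Γ.Subgraph) : Subgroup (RAAG Γ) :=
  (RAAG.incl Λ).range

theorem RAAG.sub_mono {V : Type u} {Γ : SimpleGraph V} {Λ Λ' : Γ.Subgraph} (h : Λ ≤ Λ') :
    RAAG.sub Λ ≤ RAAG.sub Λ' := by
  have key : RAAG.incl Λ = (RAAG.incl Λ').comp (RAAG.map (SimpleGraph.Subgraph.inclusion h)) := by
    refine PresentedGroup.ext fun x => ?_
    simp only [RAAG.incl, RAAG.map, MonoidHom.comp_apply, PresentedGroup.toGroup.of]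
    rfl
  rintro _ ⟨x, rfl⟩
  exact ⟨RAAG.map (SimpleGraph.Subgraph.inclusion h) x, by rw [key]; rfl⟩

/-- A splitting of `Γ`: pairwise distinct nonempty full subgraphs with
`Γ₁ ∪ Γ₂ = Γ` and `Γ₁ ∩ Γ₂ = Γ₃` (on vertices and on edges). -/
structure IsSplitting {V : Type u} {Γ : SimpleGraph V} (Γ₁ Γ₂ Γ₃ : Γ.Subgraph) : Prop where
  induced₁ : Γ₁.IsInduced
  induced₂ : Γ₂.IsInduced
  induced₃ : Γ₃.IsInduced
  nonempty₁ : Γ₁.verts.Nonempty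
  nonempty₂ : Γ₂.verts.Nonempty
  nonempty₃ : Γ₃.verts.Nonempty
  ne₁₂ : Γ₁ ≠ Γ₂
  ne₁₃ : Γ₁ ≠ Γ₃
  ne₂₃ : Γ₂ ≠ Γ₃
  union : Γ₁ ⊔ Γ₂ = ⊤
  inter : Γ₁ ⊓ Γ₂ = Γ₃

theorem IsSplitting.le₁ {V : Type u} {Γ : SimpleGraph V} {Γ₁ Γ₂ Γ₃ : Γ.Subgraph}
    (h : IsSplitting Γ₁ Γ₂ Γ₃) : Γ₃ ≤ Γ₁ := h.inter ▸ inf_le_left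

theorem IsSplitting.le₂ {V : Type u} {Γ : SimpleGraph V} {Γ₁ Γ₂ Γ₃ : Γ.Subgraph}
    (h : IsSplitting Γ₁ Γ₂ Γ₃) : Γ₃ ≤ Γ₂ := h.inter ▸ inf_le_right

/-- A real character (the additive group `ℝ` is written multiplicatively) is discrete if its
image is an infinite cyclic group. -/
def IsDiscreteCharacter {G : Type u} [Group G] (f : G →* Multiplicative ℝ) : Prop :=
  IsCyclic f.range ∧ Infinite f.range

/-- The restriction `f_Λ : A_Λ → ℝ` of a character of `A_Γ`. -/
def RAAG.restrict {V : Type u} {Γ : SimpleGraph V} (f : RAAG Γ →* Multiplicative ℝ)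
    (Λ : Γ.Subgraph) : RAAG Λ.coe →* Multiplicative ℝ :=
  f.comp (RAAG.incl Λ)

/-- The index `I_{Γ,Λ} = [f(A_Γ) : f(A_Λ)]`, an element of `ℕ ∪ {∞}`. -/
noncomputable def RAAG.imageIndex {V : Type u} {Γ : SimpleGraph V}
    (f : RAAG Γ →* Multiplicative ℝ) (Λ : Γ.Subgraph) : ℕ∞ :=
  ENat.card (f.range ⧸ ((RAAG.sub Λ).map f).subgroupOf f.range)

/-! ### Graphs (loops and multiple edges allowed) and graphs of groups -/

/-- A graph, possibly with loops and multiple edges, whose edges carry a chosen orientation.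
Every geometric edge occurs exactly once in `E`. -/
structure OrientedGraph : Type (u + 1) where
  V : Type u
  E : Type u
  src : E → V
  tgt : E → V

namespace OrientedGraph

/-- The simple graph obtained by forgetting loops, multiplicities and orientations. -/
def toSimpleGraph (X : OrientedGraph.{u}) : SimpleGraph X.V :=
  SimpleGraph.fromRel fun v w => ∃ e, X.src e = v ∧ X.tgt e = w

/-- A graph is a tree if it has no loops, no multiple edges, and it is connected and has no
cycles. -/
structure IsTree (X : OrientedGraph.{u}) : Prop where
  loopless : ∀ e, X.src e ≠ X.tgt e
  simple : ∀ e e', s(X.src e, X.tgt e) = s(X.src e', X.tgt e') → e = e'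
  tree : X.toSimpleGraph.IsTree

/-- The actions of `K` on vertices and edges form an action by orientation preserving graph
automorphisms; in particular, it is an action without inversions. -/
structure IsAction (K : Type u) [Group K] (X : OrientedGraph.{u})
    [MulAction K X.V] [MulAction K X.E] : Prop where
  src_smul : ∀ (k : K) (e : X.E), X.src (k • e) = k • X.src e
  tgt_smul : ∀ (k : K) (e : X.E), X.tgt (k • e) = k • X.tgt e

end OrientedGraph

/-- A graph of groups: a graph with a group at every vertex and every edge, and injective
homomorphisms from each edge group to the vertex groups at the two ends of the edge. -/
structure GraphOfGroups : Type (u + 1) extends OrientedGraph.{u} where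
  vertexGroup : V → Type u
  edgeGroup : E → Type u
  [instVertexGroup : ∀ v, Group (vertexGroup v)]
  [instEdgeGroup : ∀ e, Group (edgeGroup e)]
  srcHom : ∀ e, edgeGroup e →* vertexGroup (src e)
  tgtHom : ∀ e, edgeGroup e →* vertexGroup (tgt e)
  srcHom_injective : ∀ e, Function.Injective (srcHom e)
  tgtHom_injective : ∀ e, Function.Injective (tgtHom e)

namespace GraphOfGroups

attribute [instance] GraphOfGroups.instVertexGroup GraphOfGroups.instEdgeGroup

/-- The free product of all vertex groups and of the free group on the edges. -/
abbrev PrePathGroup (𝒢 : GraphOfGroups.{u}) : Type u :=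
  Monoid.Coprod (Monoid.CoprodI 𝒢.vertexGroup) (FreeGroup 𝒢.E)

/-- The element `g` of a vertex group, in the free product. -/
def preVertex (𝒢 : GraphOfGroups.{u}) {v : 𝒢.V} (g : 𝒢.vertexGroup v) : 𝒢.PrePathGroup :=
  Monoid.Coprod.inl (Monoid.CoprodI.of g)

/-- The generator `t_e` of an edge `e`, in the free product. -/
def preEdge (𝒢 : GraphOfGroups.{u}) (e : 𝒢.E) : 𝒢.PrePathGroup :=
  Monoid.Coprod.inr (FreeGroup.of e)

/-- The normal subgroup generated by the relations `t_e · c · t_e⁻¹ = c` for `c` in the edge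
group of `e`, where on the left `c` is viewed at the target of `e` and on the right at its
source. -/
def relators (𝒢 : GraphOfGroups.{u}) : Subgroup 𝒢.PrePathGroup :=
  Subgroup.normalClosure
    {r | ∃ (e : 𝒢.E) (c : 𝒢.edgeGroup e),
      r = 𝒢.preEdge e * 𝒢.preVertex (𝒢.tgtHom e c) * (𝒢.preEdge e)⁻¹
        * (𝒢.preVertex (𝒢.srcHom e c))⁻¹}

instance (𝒢 : GraphOfGroups.{u}) : 𝒢.relators.Normal :=
  Subgroup.normalClosure_normal

/-- The path group `F(𝒢)` of Serre. -/
abbrev PathGroup (𝒢 : GraphOfGroups.{u}) : Type u := 𝒢.PrePathGroup ⧸ 𝒢.relators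

/-- `𝒢.IsPathElement v w x` says that `x ∈ F(𝒢)` is the element `g₀ t₁ g₁ ⋯ tₙ gₙ` carried by
some path from `v` to `w`: these elements are built from elements of vertex groups and edge
generators by concatenation and inversion of paths. -/
inductive IsPathElement (𝒢 : GraphOfGroups.{u}) : 𝒢.V → 𝒢.V → 𝒢.PathGroup → Prop
  | vertex (v : 𝒢.V) (g : 𝒢.vertexGroup v) :
      IsPathElement 𝒢 v v (QuotientGroup.mk (𝒢.preVertex g))
  | edge (e : 𝒢.E) :
      IsPathElement 𝒢 (𝒢.src e) (𝒢.tgt e) (QuotientGroup.mk (𝒢.preEdge e))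
  | inv {v w : 𝒢.V} {x : 𝒢.PathGroup} :
      IsPathElement 𝒢 v w x → IsPathElement 𝒢 w v x⁻¹
  | mul {u v w : 𝒢.V} {x y : 𝒢.PathGroup} :
      IsPathElement 𝒢 u v x → IsPathElement 𝒢 v w y → IsPathElement 𝒢 u w (x * y)

/-- The fundamental group `π₁(𝒢, v)`: the elements of the path group carried by closed paths
at `v`. -/
def fundamentalGroup (𝒢 : GraphOfGroups.{u}) (v : 𝒢.V) : Subgroup 𝒢.PathGroup where
  carrier := {x | 𝒢.IsPathElement v v x}
  one_mem' := by
    have h := IsPathElement.vertex (𝒢 := 𝒢) v 1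
    have h1 : (QuotientGroup.mk (𝒢.preVertex (1 : 𝒢.vertexGroup v)) : 𝒢.PathGroup) = 1 := by
      simp only [preVertex, map_one, QuotientGroup.mk_one]
    rwa [h1] at h
  mul_mem' := IsPathElement.mul
  inv_mem' := IsPathElement.inv

/-- A group `K` splits as the graph of groups `𝒢` if the underlying graph is connected and `K` is
isomorphic to the fundamental group of `𝒢` (at any base point). -/
def IsDecompositionOf (𝒢 : GraphOfGroups.{u}) (K : Type u) [Group K] : Prop :=
  𝒢.toSimpleGraph.Connected ∧ ∀ v, Nonempty (K ≃* 𝒢.fundamentalGroup v)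

end GraphOfGroups

/-! ### The quotient graph of groups of an action -/

section Quotient

variable {K : Type u} [Group K] {X : OrientedGraph.{u}} [MulAction K X.V] [MulAction K X.E]

/-- If `a • y = x` and the stabilizer of `e` fixes `x`, then conjugation by `a` embeds the
stabilizer of `e` into the stabilizer of `y`. -/
def stabilizerConj {α β : Type u} [MulAction K α] [MulAction K β] (e : α) (x y : β) (a : K)
    (h : a • y = x) (hx : ∀ k : K, k • e = e → k • x = x) :
    MulAction.stabilizer K e →* MulAction.stabilizer K y where
  toFun k := ⟨a⁻¹ * k * a, by
    rw [MulAction.mem_stabilizer_iff, mul_smul, mul_smul, h, hx _ k.2, ← h, inv_smul_smul]⟩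
  map_one' := by ext; simp
  map_mul' k l := by ext; simp [mul_assoc]

theorem stabilizerConj_injective {α β : Type u} [MulAction K α] [MulAction K β]
    (e : α) (x y : β) (a : K) (h : a • y = x) (hx : ∀ k : K, k • e = e → k • x = x) :
    Function.Injective (stabilizerConj e x y a h hx) := by
  intro k l hkl
  have h1 := congrArg Subtype.val hkl
  simp only [stabilizerConj, MonoidHom.coe_mk, OneHom.coe_mk, mul_left_inj, mul_right_inj] at h1
  exact Subtype.ext h1

theorem exists_smul_out {α : Type u} [MulAction K α] (x : α) :
    ∃ a : K, a • (Quotient.mk (MulAction.orbitRel K α) x).out = x := by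
  have h : (MulAction.orbitRel K α) x (Quotient.mk (MulAction.orbitRel K α) x).out :=
    (MulAction.orbitRel K α).symm (Quotient.mk_out (s := MulAction.orbitRel K α) x)
  exact h

/-- The quotient graph of groups of an action (without inversions) of `K` on `X`: the underlying
graph is `X / K`, the vertex and edge groups are the stabilizers in `K` of chosen
representatives, and the edge inclusions are the inclusions of stabilizers followed by
conjugation in `K` to the chosen representatives of the end points. -/
noncomputable def quotientGraphOfGroups (hX : OrientedGraph.IsAction K X) :
    GraphOfGroups.{u} where
  V := MulAction.orbitRel.Quotient K X.V
  E := MulAction.orbitRel.Quotient K X.E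
  src e := Quotient.mk (MulAction.orbitRel K X.V) (X.src e.out)
  tgt e := Quotient.mk (MulAction.orbitRel K X.V) (X.tgt e.out)
  vertexGroup v := MulAction.stabilizer K v.out
  edgeGroup e := MulAction.stabilizer K e.out
  srcHom e := stabilizerConj e.out (X.src e.out) _ (exists_smul_out (X.src e.out)).choose
    (exists_smul_out (X.src e.out)).choose_spec
    (fun k hk => by rw [← hX.src_smul, hk])
  tgtHom e := stabilizerConj e.out (X.tgt e.out) _ (exists_smul_out (X.tgt e.out)).choose
    (exists_smul_out (X.tgt e.out)).choose_spec
    (fun k hk => by rw [← hX.tgt_smul, hk])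
  srcHom_injective _ := stabilizerConj_injective ..
  tgtHom_injective _ := stabilizerConj_injective ..

end Quotient

/-! ### The Bass–Serre tree of an amalgamated product -/

section BassSerre

variable {G : Type u} [Group G] {A B C : Subgroup G}

/-- The Bass–Serre graph of subgroups `A`, `B` of `G` with common subgroup `C`: the vertices are
the left cosets of `A` and of `B`, the edges are the left cosets of `C`, and the edge `gC` joins
`gA` to `gB`. -/
def bassSerreGraph (hA : C ≤ A) (hB : C ≤ B) : OrientedGraph.{u} where
  V := (G ⧸ A) ⊕ (G ⧸ B)
  E := G ⧸ C
  src e := Sum.inl (Subgroup.quotientMapOfLE hA e)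
  tgt e := Sum.inr (Subgroup.quotientMapOfLE hB e)

/-- `G` acts on the vertices by left multiplication. -/
instance (hA : C ≤ A) (hB : C ≤ B) : MulAction G (bassSerreGraph hA hB).V :=
  inferInstanceAs (MulAction G ((G ⧸ A) ⊕ (G ⧸ B)))

/-- `G` acts on the edges by left multiplication. -/
instance (hA : C ≤ A) (hB : C ≤ B) : MulAction G (bassSerreGraph hA hB).E :=
  inferInstanceAs (MulAction G (G ⧸ C))

/-- Every subgroup of `G` acts on the Bass–Serre graph. -/
theorem bassSerreGraph_isAction (K : Subgroup G) (hA : C ≤ A) (hB : C ≤ B) :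
    OrientedGraph.IsAction K (bassSerreGraph hA hB) where
  src_smul k e := by
    induction e using Quotient.inductionOn with | _ g => rfl
  tgt_smul k e := by
    induction e using Quotient.inductionOn with | _ g => rfl

end BassSerre

/-- The Bass–Serre tree of `A_Γ = A_{Γ₁} *_{A_{Γ₃}} A_{Γ₂}` for a splitting of `Γ`. -/
def IsSplitting.bassSerreTree {V : Type u} {Γ : SimpleGraph V} {Γ₁ Γ₂ Γ₃ : Γ.Subgraph}
    (h : IsSplitting Γ₁ Γ₂ Γ₃) : OrientedGraph.{u} :=
  bassSerreGraph (RAAG.sub_mono h.le₁) (RAAG.sub_mono h.le₂)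

/-- The quotient graph of groups of the action of `ker f` on the Bass–Serre tree. -/
noncomputable def IsSplitting.kerGraphOfGroups {V : Type u} {Γ : SimpleGraph V}
    {Γ₁ Γ₂ Γ₃ : Γ.Subgraph} (h : IsSplitting Γ₁ Γ₂ Γ₃) (f : RAAG Γ →* Multiplicative ℝ) :
    GraphOfGroups.{u} :=
  quotientGraphOfGroups
    (bassSerreGraph_isAction f.ker (RAAG.sub_mono h.le₁) (RAAG.sub_mono h.le₂))

/-!
The proof avoids normal forms in amalgamated products, and works instead with potentials: a graph
has potentials if every cochain on its edges with values in a group, abelian or not, is the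
coboundary of a function on its vertices. This expresses that all its loops are null-homotopic.

A full subgraph `Λ` gives a retraction of `A_Γ` onto `A_Λ`, so `A_Λ` embeds into `A_Γ`, and
composing retractions gives `A_{Γ₁} ∩ A_{Γ₂} = A_{Γ₃}`. The universal property of the amalgamated
product is read off from the presentations (`IsSplitting.exists_hom`). Given a cochain `c` with
values in `H` on the Bass–Serre graph, one twists the action of the second factor on `A_Γ × H` by
`c`; by the universal property the two factors together give an action of `A_Γ`, and the orbit of
`(1, 1)` is the graph of a potential (`IsAmalgam.hasPotentials`). Potentials with values in `ℤ/2`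
show that every edge is a bridge, hence that the graph is a tree (`IsAmalgam.isTree`).

The structure theorem holds for every action without inversions of a group `K` on a connected
graph `X` with potentials (`OrientedGraph.IsAction.isDecompositionOf`). The choices of
representatives and of translating elements in the quotient graph of groups define a cochain on
`X` with values in the path group. A potential `Φ` of it is equivariant up to vertex group
elements, which yields a homomorphism `ρ` from `K` to the fundamental group. It is inverse to the
obvious map from the path group to `K`, because on the element `y` carried by a path the
composition is the conjugation of `y` by a gauge transformation which is trivial at the base point.

For a subgroup `S` of `A_Γ`, the orbits of `ker f` on the cosets of `S` are the cosets of `f(S)`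
in the image of `f`, and the stabilizers are conjugate to `ker f ∩ S`. This describes vertices and
edges; a nontrivial subgroup of `ℤ` has finite index, and every vertex is the end of an edge, so
the graph is finite if `f₃ ≠ 0`.

If `f₃ = 0`, let `χ` be the character with values in `ℤ` given by `f`. It lifts to a homomorphism
from `A_Γ` to `FreeGroup ℤ ⋊ ℤ`, where `ℤ` acts by shifts: the generators `v` of one part go to
powers `t ^ χ v` of the stable letter, those of the other part to the conjugates
`x_0 t ^ χ v x_0⁻¹` or, if `χ` vanishes on that part, to `x_0`. The kernel of `χ` is then mapped to
`FreeGroup ℤ`, and its image is large enough to surject onto a free group of infinite rank.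
-/

/-! ### Right-angled Artin groups of full subgraphs and splittings -/

namespace RAAG

section Lift

variable {V : Type u} {H : Type*} {Γ : SimpleGraph V} [Group H]

/-- The generator of `A_Γ` attached to a vertex. -/
def of (Γ : SimpleGraph V) (v : V) : RAAG Γ := PresentedGroup.of v

theorem commute_of {v w : V} (h : Γ.Adj v w) : Commute (of Γ v) (of Γ w) := by
  have h1 : of Γ v * of Γ w * (of Γ v)⁻¹ * (of Γ w)⁻¹ = 1 :=
    PresentedGroup.one_of_mem ⟨v, w, h, rfl⟩
  have h2 : of Γ v * of Γ w = of Γ w * of Γ v := by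
    rwa [mul_inv_eq_one, mul_inv_eq_iff_eq_mul] at h1
  exact h2

/-- The universal property of `A_Γ`. -/
def lift (φ : V → H) (h : ∀ v w, Γ.Adj v w → Commute (φ v) (φ w)) : RAAG Γ →* H :=
  PresentedGroup.toGroup (f := φ) (by
    rintro r ⟨v, w, hvw, rfl⟩
    simp only [map_mul, map_inv, FreeGroup.lift_apply_of]
    rw [(h v w hvw).eq]
    group)

@[simp]
theorem lift_of (φ : V → H) (h : ∀ v w, Γ.Adj v w → Commute (φ v) (φ w)) (v : V) :
    lift φ h (of Γ v) = φ v :=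
  PresentedGroup.toGroup.of _

theorem hom_ext {φ ψ : RAAG Γ →* H} (h : ∀ v, φ (of Γ v) = ψ (of Γ v)) : φ = ψ :=
  PresentedGroup.ext h

@[simp]
theorem map_of {W : Type u} {Δ : SimpleGraph W} (φ : Γ →g Δ) (v : V) :
    map φ (of Γ v) = of Δ (φ v) :=
  PresentedGroup.toGroup.of _

@[simp]
theorem incl_of (Λ : Γ.Subgraph) (v : Λ.verts) : incl Λ (of Λ.coe v) = of Γ v :=
  map_of Λ.hom v

theorem of_mem_sub {Λ : Γ.Subgraph} {v : V} (hv : v ∈ Λ.verts) : of Γ v ∈ sub Λ :=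
  ⟨of Λ.coe ⟨v, hv⟩, incl_of Λ ⟨v, hv⟩⟩

/-- The natural map `A_Λ → A_Γ`, with values in its image. -/
def toSub (Λ : Γ.Subgraph) : RAAG Λ.coe →* sub Λ :=
  (incl Λ).codRestrict (sub Λ) fun x => ⟨x, rfl⟩

theorem toSub_of (Λ : Γ.Subgraph) (v : Λ.verts) :
    toSub Λ (of Λ.coe v) = ⟨of Γ v, of_mem_sub v.2⟩ :=
  Subtype.ext (incl_of Λ v)

theorem incl_comp_map_inclusion {Λ Λ' : Γ.Subgraph} (h : Λ ≤ Λ') :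
    (incl Λ').comp (map (SimpleGraph.Subgraph.inclusion h)) = incl Λ :=
  hom_ext fun v => by simp

end Lift

section Retraction

variable {V : Type u} {Γ : SimpleGraph V}

open Classical in
/-- The retraction of `A_Γ` onto `A_Λ`, for a full subgraph `Λ`, which kills the generators
outside `Λ`. -/
noncomputable def retraction {Λ : Γ.Subgraph} (hΛ : Λ.IsInduced) : RAAG Γ →* RAAG Λ.coe :=
  lift (fun v => if h : v ∈ Λ.verts then of Λ.coe ⟨v, h⟩ else 1) (by
    intro v w hvw
    by_cases hv : v ∈ Λ.verts
    · by_cases hw : w ∈ Λ.verts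
      · simp only [hv, hw, dite_true]
        exact commute_of (Γ := Λ.coe) (hΛ hv hw hvw)
      · simp [hw]
    · simp [hv])

theorem retraction_of_mem {Λ : Γ.Subgraph} (hΛ : Λ.IsInduced) {v : V} (hv : v ∈ Λ.verts) :
    retraction hΛ (of Γ v) = of Λ.coe ⟨v, hv⟩ := by
  simp [retraction, hv]

theorem retraction_of_notMem {Λ : Γ.Subgraph} (hΛ : Λ.IsInduced) {v : V} (hv : v ∉ Λ.verts) :
    retraction hΛ (of Γ v) = 1 := by
  simp [retraction, hv]

theorem retraction_incl {Λ : Γ.Subgraph} (hΛ : Λ.IsInduced) (x : RAAG Λ.coe) :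
    retraction hΛ (incl Λ x) = x := by
  have : (retraction hΛ).comp (incl Λ) = MonoidHom.id _ :=
    hom_ext fun v => by simp [retraction_of_mem hΛ v.2]
  exact DFunLike.congr_fun this x

theorem incl_injective {Λ : Γ.Subgraph} (hΛ : Λ.IsInduced) : Function.Injective (incl Λ) :=
  Function.LeftInverse.injective (retraction_incl hΛ)

theorem map_inclusion_injective {Λ Λ' : Γ.Subgraph} (hΛ : Λ.IsInduced) (h : Λ ≤ Λ') :
    Function.Injective (map (SimpleGraph.Subgraph.inclusion h)) := by
  refine Function.Injective.of_comp (f := incl Λ') ?_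
  rw [← MonoidHom.coe_comp, incl_comp_map_inclusion h]
  exact incl_injective hΛ

theorem incl_retraction_of_mem_sub {Λ : Γ.Subgraph} (hΛ : Λ.IsInduced) {x : RAAG Γ}
    (hx : x ∈ sub Λ) : incl Λ (retraction hΛ x) = x := by
  obtain ⟨y, rfl⟩ := hx
  rw [retraction_incl]

/-- The retractions onto `A_{Λ₁}` and `A_{Λ₂}` compose to the retraction onto the subgroup of
the intersection. -/
theorem sub_inf_sub_le {Λ₁ Λ₂ Λ₃ : Γ.Subgraph} (h₁ : Λ₁.IsInduced) (h₂ : Λ₂.IsInduced)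
    (h₃ : Λ₃.IsInduced) (h : Λ₁.verts ∩ Λ₂.verts = Λ₃.verts) : sub Λ₁ ⊓ sub Λ₂ ≤ sub Λ₃ := by
  have key : ((incl Λ₁).comp (retraction h₁)).comp ((incl Λ₂).comp (retraction h₂)) =
      (incl Λ₃).comp (retraction h₃) := by
    refine hom_ext fun v => ?_
    have h3 : v ∈ Λ₃.verts ↔ v ∈ Λ₁.verts ∧ v ∈ Λ₂.verts := by rw [← h]; rfl
    by_cases hv₂ : v ∈ Λ₂.verts
    · by_cases hv₁ : v ∈ Λ₁.verts
      · simp [retraction_of_mem, hv₁, hv₂, h3.2 ⟨hv₁, hv₂⟩]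
      · simp [retraction_of_mem, retraction_of_notMem, hv₁, hv₂, h3]
    · simp [retraction_of_notMem, hv₂, h3]
  rintro x ⟨hx₁, hx₂⟩
  refine ⟨retraction h₃ x, ?_⟩
  have := DFunLike.congr_fun key x
  simp only [MonoidHom.comp_apply] at this
  rw [← this, incl_retraction_of_mem_sub h₂ hx₂, incl_retraction_of_mem_sub h₁ hx₁]

end Retraction

end RAAG

namespace IsSplitting

open RAAG

variable {V : Type u} {H : Type*} [Group H] {Γ : SimpleGraph V} {Γ₁ Γ₂ Γ₃ : Γ.Subgraph}

theorem mem_or_mem (h : IsSplitting Γ₁ Γ₂ Γ₃) (v : V) : v ∈ Γ₁.verts ∨ v ∈ Γ₂.verts := by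
  have : v ∈ (Γ₁ ⊔ Γ₂).verts := by rw [h.union]; trivial
  exact this

theorem adj_or_adj (h : IsSplitting Γ₁ Γ₂ Γ₃) {v w : V} (hvw : Γ.Adj v w) :
    Γ₁.Adj v w ∨ Γ₂.Adj v w := by
  have : (Γ₁ ⊔ Γ₂).Adj v w := by rw [h.union]; exact hvw
  exact this

theorem verts_inter (h : IsSplitting Γ₁ Γ₂ Γ₃) : Γ₁.verts ∩ Γ₂.verts = Γ₃.verts := by
  rw [← h.inter]; rfl

/-- A splitting is symmetric in the two parts. -/
theorem symm (h : IsSplitting Γ₁ Γ₂ Γ₃) : IsSplitting Γ₂ Γ₁ Γ₃ where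
  induced₁ := h.induced₂
  induced₂ := h.induced₁
  induced₃ := h.induced₃
  nonempty₁ := h.nonempty₂
  nonempty₂ := h.nonempty₁
  nonempty₃ := h.nonempty₃
  ne₁₂ := h.ne₁₂.symm
  ne₁₃ := h.ne₂₃
  ne₂₃ := h.ne₁₃
  union := by rw [sup_comm, h.union]
  inter := by rw [inf_comm, h.inter]

/-- Fullness turns `Γ₁ ≠ Γ₃` into a vertex of `Γ₁` outside `Γ₂`. -/
theorem exists_vertex (h : IsSplitting Γ₁ Γ₂ Γ₃) : ∃ v ∈ Γ₁.verts, v ∉ Γ₂.verts := by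
  by_contra! hcon
  refine h.ne₁₃ (le_antisymm (And.intro ?_ ?_) h.le₁)
  · intro v hv
    rw [← h.verts_inter]
    exact ⟨hv, hcon v hv⟩
  · intro v w hvw
    refine h.induced₃ ?_ ?_ hvw.adj_sub
    · rw [← h.verts_inter]
      exact ⟨hvw.fst_mem, hcon v hvw.fst_mem⟩
    · rw [← h.verts_inter]
      exact ⟨hvw.snd_mem, hcon w hvw.snd_mem⟩

theorem hom_ext (h : IsSplitting Γ₁ Γ₂ Γ₃) {φ ψ : RAAG Γ →* H}
    (h₁ : φ.comp (incl Γ₁) = ψ.comp (incl Γ₁)) (h₂ : φ.comp (incl Γ₂) = ψ.comp (incl Γ₂)) :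
    φ = ψ := by
  refine RAAG.hom_ext fun v => ?_
  rcases h.mem_or_mem v with hv | hv
  · simpa using DFunLike.congr_fun h₁ (of Γ₁.coe ⟨v, hv⟩)
  · simpa using DFunLike.congr_fun h₂ (of Γ₂.coe ⟨v, hv⟩)

theorem exists_hom (h : IsSplitting Γ₁ Γ₂ Γ₃) (φ₁ : RAAG Γ₁.coe →* H) (φ₂ : RAAG Γ₂.coe →* H)
    (h₁₂ : φ₁.comp (map (SimpleGraph.Subgraph.inclusion h.le₁)) =
      φ₂.comp (map (SimpleGraph.Subgraph.inclusion h.le₂))) :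
    ∃ θ : RAAG Γ →* H, θ.comp (incl Γ₁) = φ₁ ∧ θ.comp (incl Γ₂) = φ₂ := by
  classical
  let t : V → H := fun v => if hv : v ∈ Γ₁.verts then φ₁ (of Γ₁.coe ⟨v, hv⟩)
    else φ₂ (of Γ₂.coe ⟨v, (h.mem_or_mem v).resolve_left hv⟩)
  have t₁ : ∀ v (hv : v ∈ Γ₁.verts), t v = φ₁ (of Γ₁.coe ⟨v, hv⟩) := fun v hv => by
    simp [t, hv]
  have t₂ : ∀ v (hv : v ∈ Γ₂.verts), t v = φ₂ (of Γ₂.coe ⟨v, hv⟩) := fun v hv => by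
    by_cases hv₁ : v ∈ Γ₁.verts
    · have hv₃ : v ∈ Γ₃.verts := by rw [← h.verts_inter]; exact ⟨hv₁, hv⟩
      rw [t₁ v hv₁]
      have := DFunLike.congr_fun h₁₂ (of Γ₃.coe ⟨v, hv₃⟩)
      rwa [MonoidHom.comp_apply, MonoidHom.comp_apply, map_of, map_of] at this
    · simp [t, hv₁]
  refine ⟨lift t ?_, RAAG.hom_ext fun v => ?_, RAAG.hom_ext fun v => ?_⟩
  · intro v w hvw
    rcases h.adj_or_adj hvw with hvw | hvw
    · rw [t₁ v hvw.fst_mem, t₁ w hvw.snd_mem]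
      exact (commute_of (Γ := Γ₁.coe) (v := ⟨v, hvw.fst_mem⟩) (w := ⟨w, hvw.snd_mem⟩) hvw).map φ₁
    · rw [t₂ v hvw.fst_mem, t₂ w hvw.snd_mem]
      exact (commute_of (Γ := Γ₂.coe) (v := ⟨v, hvw.fst_mem⟩) (w := ⟨w, hvw.snd_mem⟩) hvw).map φ₂
  · simp [t₁ v v.2]
  · simp [t₂ v v.2]

open CategoryTheory in
theorem isPushout (h : IsSplitting Γ₁ Γ₂ Γ₃) :
    IsPushout
      (GrpCat.ofHom (RAAG.map (SimpleGraph.Subgraph.inclusion h.le₁)))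
      (GrpCat.ofHom (RAAG.map (SimpleGraph.Subgraph.inclusion h.le₂)))
      (GrpCat.ofHom (RAAG.incl Γ₁)) (GrpCat.ofHom (RAAG.incl Γ₂)) := by
  have w : GrpCat.ofHom (RAAG.map (SimpleGraph.Subgraph.inclusion h.le₁)) ≫
        GrpCat.ofHom (RAAG.incl Γ₁) =
      GrpCat.ofHom (RAAG.map (SimpleGraph.Subgraph.inclusion h.le₂)) ≫
        GrpCat.ofHom (RAAG.incl Γ₂) := by
    rw [← GrpCat.ofHom_comp, ← GrpCat.ofHom_comp, incl_comp_map_inclusion,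
      incl_comp_map_inclusion]
  have ex : ∀ s : Limits.PushoutCocone
      (GrpCat.ofHom (RAAG.map (SimpleGraph.Subgraph.inclusion h.le₁)))
      (GrpCat.ofHom (RAAG.map (SimpleGraph.Subgraph.inclusion h.le₂))),
      ∃ θ : RAAG Γ →* s.pt, θ.comp (incl Γ₁) = s.inl.hom ∧ θ.comp (incl Γ₂) = s.inr.hom :=
    fun s => h.exists_hom _ _ (congrArg GrpCat.Hom.hom s.condition)
  choose θ hθ₁ hθ₂ using ex
  refine ⟨⟨w⟩, ⟨Limits.PushoutCocone.IsColimit.mk w (fun s => GrpCat.ofHom (θ s))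
    (fun s => GrpCat.hom_ext (hθ₁ s)) (fun s => GrpCat.hom_ext (hθ₂ s)) ?_⟩⟩
  intro s m h₁ h₂
  refine GrpCat.hom_ext (h.hom_ext ?_ ?_)
  · exact (congrArg GrpCat.Hom.hom h₁).trans (hθ₁ s).symm
  · exact (congrArg GrpCat.Hom.hom h₂).trans (hθ₂ s).symm

end IsSplitting

/-! ### Potentials and the Bass–Serre tree of an amalgamated product -/

/-- The group `G` is the amalgamated product of its subgroups `A` and `B` over `C`: it is
generated by `A` and `B`, these meet in `C`, and homomorphisms on `A` and `B` which agree on `C`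
extend to `G`. -/
structure IsAmalgam {G : Type u} [Group G] (A B C : Subgroup G) : Prop where
  left_le : C ≤ A
  right_le : C ≤ B
  inf_le : A ⊓ B ≤ C
  sup_eq_top : A ⊔ B = ⊤
  exists_hom : ∀ {H : Type u} [Group H] (φ : A →* H) (ψ : B →* H),
    (∀ c (hc : c ∈ C), φ ⟨c, left_le hc⟩ = ψ ⟨c, right_le hc⟩) →
    ∃ θ : G →* H, (∀ a : A, θ a = φ a) ∧ ∀ b : B, θ b = ψ b

namespace OrientedGraph

/-- Connectedness of an oriented graph, as an induction principle: a property which holds at one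
end of an edge if and only if it holds at the other, and which holds at some vertex, holds at
every vertex. -/
def IsPreconnected (X : OrientedGraph.{u}) : Prop :=
  ∀ P : X.V → Prop, (∀ e, P (X.src e) ↔ P (X.tgt e)) → ∀ x y, P x → P y

/-- Every cochain on the edges, with values in an arbitrary group, is the coboundary of a
function on the vertices. -/
def HasPotentials (X : OrientedGraph.{u}) : Prop :=
  ∀ (H : Type u) [Group H] (c : X.E → H), ∃ Φ : X.V → H, ∀ e, Φ (X.tgt e) = Φ (X.src e) * c e

variable {X : OrientedGraph.{u}}

theorem reachable_src_tgt (e : X.E) : X.toSimpleGraph.Reachable (X.src e) (X.tgt e) := by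
  by_cases h : X.src e = X.tgt e
  · rw [h]
  · refine SimpleGraph.Adj.reachable ?_
    rw [toSimpleGraph, SimpleGraph.fromRel_adj]
    exact ⟨h, Or.inl ⟨e, rfl, rfl⟩⟩

theorem IsPreconnected.preconnected (h : X.IsPreconnected) : X.toSimpleGraph.Preconnected :=
  fun x y => h (fun z => X.toSimpleGraph.Reachable x z)
    (fun e => ⟨fun H => H.trans (reachable_src_tgt e),
      fun H => H.trans (reachable_src_tgt e).symm⟩) x y (SimpleGraph.Reachable.refl x)

/-- Apply the existence of potentials to the cochain with values in `ℤ/2` which is nonzero on a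
single edge: its potential tells apart the two ends of the edge, and it is constant on the
remaining graph. So every edge is a bridge. -/
theorem HasPotentials.isAcyclic (h : X.HasPotentials) : X.toSimpleGraph.IsAcyclic := by
  classical
  rw [SimpleGraph.isAcyclic_iff_forall_adj_isBridge]
  intro v w hvw
  obtain ⟨-, hvw⟩ := (SimpleGraph.fromRel_adj _ _ _).1 hvw
  obtain ⟨e, he⟩ : ∃ e, s(X.src e, X.tgt e) = s(v, w) := by
    rcases hvw with ⟨e, rfl, rfl⟩ | ⟨e, rfl, rfl⟩
    · exact ⟨e, rfl⟩
    · exact ⟨e, Sym2.eq_swap⟩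
  obtain ⟨Φ, hΦ⟩ := h (Multiplicative (ULift.{u} (ZMod 2)))
    (fun e' => if e' = e then Multiplicative.ofAdd ⟨1⟩ else 1)
  rw [← he, SimpleGraph.isBridge_iff]
  intro hr
  have key : ∀ x y, (X.toSimpleGraph.deleteEdges {s(X.src e, X.tgt e)}).Adj x y →
      Φ x = Φ y := by
    intro x y hxy
    rw [SimpleGraph.deleteEdges_adj, toSimpleGraph, SimpleGraph.fromRel_adj] at hxy
    obtain ⟨⟨-, hxy⟩, hne⟩ := hxy
    rcases hxy with ⟨e', rfl, rfl⟩ | ⟨e', rfl, rfl⟩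
    · have hee : e' ≠ e := by rintro rfl; exact hne rfl
      simp [hΦ, hee]
    · have hee : e' ≠ e := by rintro rfl; exact hne Sym2.eq_swap
      simp [hΦ, hee]
  have hc : ∀ x y, (X.toSimpleGraph.deleteEdges {s(X.src e, X.tgt e)}).Reachable x y →
      Φ x = Φ y := by
    rintro x y ⟨p⟩
    induction p with
    | nil => rfl
    | cons hadj _ ih => exact (key _ _ hadj).trans ih
  have h1 := hc _ _ hr
  rw [hΦ e, if_pos rfl, eq_comm, mul_eq_left] at h1
  exact absurd (congrArg ULift.down (Multiplicative.ofAdd.injective h1)) (by decide)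

theorem isTree_of_hasPotentials [Nonempty X.V] (hc : X.IsPreconnected) (hp : X.HasPotentials)
    (hl : ∀ e, X.src e ≠ X.tgt e)
    (hs : ∀ e e', s(X.src e, X.tgt e) = s(X.src e', X.tgt e') → e = e') : X.IsTree where
  loopless := hl
  simple := hs
  tree := ⟨⟨hc.preconnected⟩, hp.isAcyclic⟩

end OrientedGraph

namespace IsAmalgam

variable {G : Type u} [Group G] {A B C : Subgroup G}

theorem eq_top_of_le (h : IsAmalgam A B C) {S : Subgroup G} (hA : A ≤ S) (hB : B ≤ S) (g : G) :
    g ∈ S := by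
  have : A ⊔ B ≤ S := sup_le hA hB
  rw [h.sup_eq_top] at this
  exact this trivial

theorem isPreconnected (h : IsAmalgam A B C) :
    (bassSerreGraph h.left_le h.right_le).IsPreconnected := by
  intro P hP x y hx
  let Q : G → Prop := fun g => P (Sum.inl (g : G ⧸ A))
  have hQ : ∀ g, Q g ↔ P (Sum.inr (g : G ⧸ B)) := fun g => hP (g : G ⧸ C)
  let S : Subgroup G :=
    { carrier := {s | ∀ g, Q (g * s) ↔ Q g}
      one_mem' := fun g => by rw [mul_one]
      mul_mem' := fun {s t} hs ht g => by rw [← mul_assoc, ht, hs]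
      inv_mem' := fun {s} hs g => by rw [← hs, inv_mul_cancel_right] }
  have hA : A ≤ S := fun a ha g => by
    have : ((g * a : G) : G ⧸ A) = g := QuotientGroup.mk_mul_of_mem g ha
    simp only [Q, this]
  have hB : B ≤ S := fun b hb g => by
    have : ((g * b : G) : G ⧸ B) = g := QuotientGroup.mk_mul_of_mem g hb
    rw [hQ, hQ, this]
  have hS : ∀ g g', Q g → Q g' := fun g g' hg => by
    have := (h.eq_top_of_le hA hB (g⁻¹ * g')) g
    rw [mul_inv_cancel_left] at this
    exact this.2 hg
  have hx' : ∃ g, Q g := by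
    rcases x with x | x
    · induction x using Quotient.inductionOn with | _ g => exact ⟨g, hx⟩
    · induction x using Quotient.inductionOn with | _ g => exact ⟨g, (hQ g).2 hx⟩
  obtain ⟨g, hg⟩ := hx'
  rcases y with y | y
  · induction y using Quotient.inductionOn with | _ g' => exact hS g g' hg
  · induction y using Quotient.inductionOn with | _ g' => exact (hQ g').1 (hS g g' hg)

/-- Let `A` act on `G × H` through the left factor, and `B` by the same action conjugated by
`(g, h) ↦ (g, h c(g))`. The two actions agree on `C`, so they define an action of `G`, and the
orbit of `(1, 1)` is the graph of a potential for `c`. -/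
theorem hasPotentials (h : IsAmalgam A B C) :
    (bassSerreGraph h.left_le h.right_le).HasPotentials := by
  intro H _ c
  let d : G → H := fun g => c (g : G ⧸ C)
  have hd : ∀ g, ∀ x ∈ C, d (g * x) = d g := fun g x hx =>
    congrArg c (QuotientGroup.mk_mul_of_mem g hx)
  let R : G →* Equiv.Perm (G × H) :=
    { toFun := fun x => (Equiv.mulRight x⁻¹).prodCongr (Equiv.refl H)
      map_one' := by ext p <;> simp
      map_mul' := fun x y => by ext p <;> simp [mul_assoc] }
  have hR : ∀ x p, R x p = (p.1 * x⁻¹, p.2) := fun x p => rfl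
  let U : Equiv.Perm (G × H) :=
    { toFun := fun p => (p.1, p.2 * d p.1)
      invFun := fun p => (p.1, p.2 * (d p.1)⁻¹)
      left_inv := fun p => by simp
      right_inv := fun p => by simp }
  have hU : ∀ p, U p = (p.1, p.2 * d p.1) := fun p => rfl
  have hU' : ∀ p, U.symm p = (p.1, p.2 * (d p.1)⁻¹) := fun p => rfl
  obtain ⟨θ, hθA, hθB⟩ := h.exists_hom (R.comp A.subtype)
    ((MulAut.conj U⁻¹).toMonoidHom.comp (R.comp B.subtype)) (by
      intro x hx
      ext1 p
      have : d (p.1 * x⁻¹) = d p.1 := hd _ _ (C.inv_mem hx)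
      simp [hR, hU, hU', this])
  have hθA' : ∀ a ∈ A, ∀ p, θ a p = (p.1 * a⁻¹, p.2) := fun a ha p => by
    rw [hθA ⟨a, ha⟩]; rfl
  have hθB' : ∀ b ∈ B, ∀ p, θ b p = (p.1 * b⁻¹, p.2 * d p.1 * (d (p.1 * b⁻¹))⁻¹) :=
    fun b hb p => by rw [hθB ⟨b, hb⟩]; rfl
  have hfst : ∀ x p, (θ x p).1 = p.1 * x⁻¹ := by
    let S : Subgroup G :=
      { carrier := {x | ∀ p, (θ x p).1 = p.1 * x⁻¹}
        one_mem' := fun p => by simp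
        mul_mem' := fun {x y} hx hy p => by
          simp only [Set.mem_ofPred_eq] at hx hy
          rw [map_mul, Equiv.Perm.mul_apply, hx, hy, mul_inv_rev, mul_assoc]
        inv_mem' := fun {x} hx p => by
          simp only [Set.mem_ofPred_eq] at hx
          have := hx (θ x⁻¹ p)
          rw [← Equiv.Perm.mul_apply, ← map_mul, mul_inv_cancel, map_one,
            Equiv.Perm.one_apply] at this
          rw [this, inv_inv, inv_mul_cancel_right] }
    exact fun x => h.eq_top_of_le (S := S) (fun a ha p => by rw [hθA' a ha])
      (fun b hb p => by rw [hθB' b hb]) x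
  let T : G → H := fun x => (θ x⁻¹ (1, 1)).2
  have hT : ∀ x, θ x⁻¹ (1, 1) = (x, T x) := fun x =>
    Prod.ext (by rw [hfst]; simp) rfl
  have hTA : ∀ x, ∀ a ∈ A, T (x * a) = T x := fun x a ha => by
    have := hT (x * a)
    rw [mul_inv_rev, map_mul, Equiv.Perm.mul_apply, hT, hθA' _ (A.inv_mem ha)] at this
    exact (congrArg Prod.snd this).symm
  have hTB : ∀ x, ∀ b ∈ B, T (x * b) * d (x * b) = T x * d x := fun x b hb => by
    have := hT (x * b)
    rw [mul_inv_rev, map_mul, Equiv.Perm.mul_apply, hT, hθB' _ (B.inv_mem hb)] at this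
    have := congrArg Prod.snd this
    simp only [inv_inv] at this
    rw [← this, inv_mul_cancel_right]
  refine ⟨Sum.elim (fun x => Quotient.liftOn' x T ?_)
    (fun x => Quotient.liftOn' x (fun g => T g * d g) ?_), fun e => ?_⟩
  · intro g g' hg
    rw [QuotientGroup.leftRel_apply] at hg
    simpa using (hTA g _ hg).symm
  · intro g g' hg
    rw [QuotientGroup.leftRel_apply] at hg
    simpa using (hTB g _ hg).symm
  · induction e using Quotient.inductionOn with | _ g => rfl

theorem isTree (h : IsAmalgam A B C) : (bassSerreGraph h.left_le h.right_le).IsTree := by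
  have : Nonempty (bassSerreGraph h.left_le h.right_le).V := ⟨Sum.inl ((1 : G) : G ⧸ A)⟩
  refine OrientedGraph.isTree_of_hasPotentials h.isPreconnected h.hasPotentials
    (fun e he => Sum.inl_ne_inr he) ?_
  intro e e' hee
  induction e using Quotient.inductionOn with | _ g =>
  induction e' using Quotient.inductionOn with | _ g' =>
  have hee : (s(Sum.inl (g : G ⧸ A), Sum.inr (g : G ⧸ B)) : Sym2 ((G ⧸ A) ⊕ (G ⧸ B))) =
    s(Sum.inl (g' : G ⧸ A), Sum.inr (g' : G ⧸ B)) := hee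
  simp only [Sym2.eq_iff, Sum.inl.injEq, Sum.inr.injEq, reduceCtorEq, and_self, or_false] at hee
  exact QuotientGroup.eq.2
    (h.inf_le ⟨QuotientGroup.eq.1 hee.1, QuotientGroup.eq.1 hee.2⟩)

end IsAmalgam

namespace IsSplitting

open RAAG

variable {V : Type u} {Γ : SimpleGraph V} {Γ₁ Γ₂ Γ₃ : Γ.Subgraph}

theorem isAmalgam (h : IsSplitting Γ₁ Γ₂ Γ₃) : IsAmalgam (sub Γ₁) (sub Γ₂) (sub Γ₃) where
  left_le := sub_mono h.le₁
  right_le := sub_mono h.le₂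
  inf_le := sub_inf_sub_le h.induced₁ h.induced₂ h.induced₃ h.verts_inter
  sup_eq_top := by
    rw [eq_top_iff]
    refine fun x _ => PresentedGroup.generated_by _ _ (fun v => ?_) x
    rcases h.mem_or_mem v with hv | hv
    · exact Subgroup.mem_sup_left (of_mem_sub hv)
    · exact Subgroup.mem_sup_right (of_mem_sub hv)
  exists_hom := by
    intro H _ φ ψ hφψ
    obtain ⟨θ, h₁, h₂⟩ := h.exists_hom (φ.comp (toSub Γ₁)) (ψ.comp (toSub Γ₂)) (by
      refine RAAG.hom_ext fun v => ?_
      simp only [MonoidHom.comp_apply, map_of, toSub_of]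
      exact hφψ (of Γ v) (of_mem_sub v.2))
    refine ⟨θ, ?_, ?_⟩
    · rintro ⟨_, x, rfl⟩
      exact DFunLike.congr_fun h₁ x
    · rintro ⟨_, x, rfl⟩
      exact DFunLike.congr_fun h₂ x

end IsSplitting

/-! ### The path group of a quotient graph of groups -/

section Orbits

variable {K : Type u} [Group K] {α : Type u} [MulAction K α]

/-- The orbit of `x`, as a point of the quotient. -/
abbrev orbitMk (K : Type u) [Group K] {α : Type u} [MulAction K α] (x : α) :
    MulAction.orbitRel.Quotient K α :=
  Quotient.mk (MulAction.orbitRel K α) x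

/-- An element of `K` carrying the chosen representative of the orbit of `x` to `x`. -/
noncomputable def translator (K : Type u) [Group K] {α : Type u} [MulAction K α] (x : α) : K :=
  (exists_smul_out (K := K) x).choose

theorem translator_smul (x : α) : translator K x • (orbitMk K x).out = x :=
  (exists_smul_out x).choose_spec

theorem orbitMk_smul (k : K) (x : α) : orbitMk K (k • x) = orbitMk K x :=
  Quotient.sound (s := MulAction.orbitRel K α) (MulAction.mem_orbit x k)

theorem orbitMk_out (v : MulAction.orbitRel.Quotient K α) : orbitMk K v.out = v :=
  Quotient.out_eq v

theorem translator_smul_inv_mul_mem (k : K) (x : α) :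
    (translator K (k • x))⁻¹ * k * translator K x ∈
      MulAction.stabilizer K (orbitMk K x).out := by
  rw [MulAction.mem_stabilizer_iff, mul_smul, mul_smul, translator_smul, inv_smul_eq_iff,
    ← orbitMk_smul k x, translator_smul]

theorem translator_out_mem (v : MulAction.orbitRel.Quotient K α) :
    translator K v.out ∈ MulAction.stabilizer K v.out := by
  have := translator_smul (K := K) v.out
  rwa [orbitMk_out] at this

end Orbits

theorem OrientedGraph.IsPreconnected.mul_inv_eq {X : OrientedGraph.{u}} (hc : X.IsPreconnected)
    {H : Type u} [Group H] {c : X.E → H} {Φ Ψ : X.V → H}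
    (hΦ : ∀ e, Φ (X.tgt e) = Φ (X.src e) * c e) (hΨ : ∀ e, Ψ (X.tgt e) = Ψ (X.src e) * c e)
    (x y : X.V) : Ψ y * (Φ y)⁻¹ = Ψ x * (Φ x)⁻¹ := by
  refine hc (fun z => Ψ z * (Φ z)⁻¹ = Ψ x * (Φ x)⁻¹) (fun e => ?_) x y rfl
  have : Ψ (X.tgt e) * (Φ (X.tgt e))⁻¹ = Ψ (X.src e) * (Φ (X.src e))⁻¹ := by
    rw [hΦ, hΨ]; group
  simp only [this]

namespace GraphOfGroups

variable {𝒢 : GraphOfGroups.{u}} {K : Type u} [Group K]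

theorem preVertex_mul {v : 𝒢.V} (g h : 𝒢.vertexGroup v) :
    𝒢.preVertex (g * h) = 𝒢.preVertex g * 𝒢.preVertex h := by
  simp only [preVertex, map_mul]

/-- The universal property of the path group. -/
def pathGroupLift (φ : ∀ v, 𝒢.vertexGroup v →* K) (t : 𝒢.E → K)
    (h : ∀ e c, t e * φ _ (𝒢.tgtHom e c) * (t e)⁻¹ = φ _ (𝒢.srcHom e c)) :
    𝒢.PathGroup →* K :=
  QuotientGroup.lift 𝒢.relators (Monoid.Coprod.lift (Monoid.CoprodI.lift φ) (FreeGroup.lift t)) (by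
    refine Subgroup.normalClosure_le_normal ?_
    rintro r ⟨e, c, rfl⟩
    rw [SetLike.mem_coe, MonoidHom.mem_ker]
    simp only [map_mul, map_inv, preVertex, preEdge, Monoid.Coprod.lift_apply_inl,
      Monoid.Coprod.lift_apply_inr, FreeGroup.lift_apply_of, Monoid.CoprodI.lift_of, h,
      mul_inv_cancel])

theorem pathGroupLift_preVertex (φ : ∀ v, 𝒢.vertexGroup v →* K) (t : 𝒢.E → K)
    (h : ∀ e c, t e * φ _ (𝒢.tgtHom e c) * (t e)⁻¹ = φ _ (𝒢.srcHom e c)) {v : 𝒢.V}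
    (g : 𝒢.vertexGroup v) :
    pathGroupLift φ t h (QuotientGroup.mk (𝒢.preVertex g)) = φ v g := by
  refine (QuotientGroup.lift_mk' _ _ _).trans ?_
  simp only [preVertex, Monoid.Coprod.lift_apply_inl, Monoid.CoprodI.lift_of]

theorem pathGroupLift_preEdge (φ : ∀ v, 𝒢.vertexGroup v →* K) (t : 𝒢.E → K)
    (h : ∀ e c, t e * φ _ (𝒢.tgtHom e c) * (t e)⁻¹ = φ _ (𝒢.srcHom e c)) (e : 𝒢.E) :
    pathGroupLift φ t h (QuotientGroup.mk (𝒢.preEdge e)) = t e := by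
  refine (QuotientGroup.lift_mk' _ _ _).trans ?_
  simp only [preEdge, Monoid.Coprod.lift_apply_inr, FreeGroup.lift_apply_of]

end GraphOfGroups

namespace OrientedGraph.IsAction

open MulAction

variable {K : Type u} [Group K] {X : OrientedGraph.{u}} [MulAction K X.V] [MulAction K X.E]
  (hX : OrientedGraph.IsAction K X)

open Classical in
/-- The element `g` of the group at the vertex `v`, in the path group of the quotient graph of
groups. It is `1` by convention if `g` does not stabilize the representative of `v`. -/
noncomputable def vertexElem (v : orbitRel.Quotient K X.V) (g : K) :
    (quotientGraphOfGroups hX).PathGroup :=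
  if h : g ∈ stabilizer K v.out then
    QuotientGroup.mk ((quotientGraphOfGroups hX).preVertex (v := v) ⟨g, h⟩) else 1

/-- The generator of the path group at an edge of the quotient graph of groups. -/
noncomputable def edgeElem (ε : orbitRel.Quotient K X.E) :
    (quotientGraphOfGroups hX).PathGroup :=
  QuotientGroup.mk ((quotientGraphOfGroups hX).preEdge ε)

theorem vertexElem_of_mem {v : orbitRel.Quotient K X.V} {g : K} (h : g ∈ stabilizer K v.out) :
    hX.vertexElem v g =
      QuotientGroup.mk ((quotientGraphOfGroups hX).preVertex (v := v) ⟨g, h⟩) :=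
  dif_pos h

theorem vertexElem_mul {v : orbitRel.Quotient K X.V} {g h : K} (hg : g ∈ stabilizer K v.out)
    (hh : h ∈ stabilizer K v.out) :
    hX.vertexElem v (g * h) = hX.vertexElem v g * hX.vertexElem v h := by
  rw [hX.vertexElem_of_mem hg, hX.vertexElem_of_mem hh,
    hX.vertexElem_of_mem (mul_mem hg hh), ← QuotientGroup.mk_mul]
  exact congrArg QuotientGroup.mk (GraphOfGroups.preVertex_mul
    (𝒢 := quotientGraphOfGroups hX) (v := v) ⟨g, hg⟩ ⟨h, hh⟩)

theorem vertexElem_one (v : orbitRel.Quotient K X.V) : hX.vertexElem v 1 = 1 := by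
  have := hX.vertexElem_mul (one_mem (stabilizer K v.out)) (one_mem (stabilizer K v.out))
  rwa [mul_one, left_eq_mul] at this

theorem vertexElem_inv {v : orbitRel.Quotient K X.V} {g : K} (hg : g ∈ stabilizer K v.out) :
    hX.vertexElem v g⁻¹ = (hX.vertexElem v g)⁻¹ := by
  rw [eq_inv_iff_mul_eq_one, ← hX.vertexElem_mul (inv_mem hg) hg, inv_mul_cancel,
    hX.vertexElem_one]

theorem conj_src_mem (hX : OrientedGraph.IsAction K X) {ε : orbitRel.Quotient K X.E} {s : K}
    (hs : s ∈ stabilizer K ε.out) :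
    (translator K (X.src ε.out))⁻¹ * s * translator K (X.src ε.out) ∈
      stabilizer K (orbitMk K (X.src ε.out)).out := by
  rw [mem_stabilizer_iff] at hs ⊢
  rw [mul_smul, mul_smul, translator_smul, ← hX.src_smul, hs, inv_smul_eq_iff, translator_smul]

theorem conj_tgt_mem (hX : OrientedGraph.IsAction K X) {ε : orbitRel.Quotient K X.E} {s : K}
    (hs : s ∈ stabilizer K ε.out) :
    (translator K (X.tgt ε.out))⁻¹ * s * translator K (X.tgt ε.out) ∈
      stabilizer K (orbitMk K (X.tgt ε.out)).out := by
  rw [mem_stabilizer_iff] at hs ⊢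
  rw [mul_smul, mul_smul, translator_smul, ← hX.tgt_smul, hs, inv_smul_eq_iff, translator_smul]

/-- The defining relation of the path group. -/
theorem edgeElem_relation {ε : orbitRel.Quotient K X.E} {s : K} (hs : s ∈ stabilizer K ε.out) :
    hX.edgeElem ε * hX.vertexElem (orbitMk K (X.tgt ε.out))
        ((translator K (X.tgt ε.out))⁻¹ * s * translator K (X.tgt ε.out)) *
      (hX.edgeElem ε)⁻¹ = hX.vertexElem (orbitMk K (X.src ε.out))
        ((translator K (X.src ε.out))⁻¹ * s * translator K (X.src ε.out)) := by
  rw [hX.vertexElem_of_mem (hX.conj_src_mem hs), hX.vertexElem_of_mem (hX.conj_tgt_mem hs),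
    ← mul_inv_eq_one]
  exact (QuotientGroup.eq_one_iff _).2 (Subgroup.subset_normalClosure ⟨ε, ⟨s, hs⟩, rfl⟩)

/-- The homomorphism from the path group to `K` which is the inclusion on every vertex group,
and which sends the generator of an edge to the quotient of the two elements which translate the
chosen representatives of the orbits of its ends to these ends. -/
noncomputable def pathGroupHom : (quotientGraphOfGroups hX).PathGroup →* K :=
  GraphOfGroups.pathGroupLift (𝒢 := quotientGraphOfGroups hX)
    (fun v : orbitRel.Quotient K X.V => (stabilizer K v.out).subtype)
    (fun ε : orbitRel.Quotient K X.E =>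
      (translator K (X.src ε.out))⁻¹ * translator K (X.tgt ε.out)) (by
    intro ε s
    change (translator K (X.src (Quotient.out ε)))⁻¹ * translator K (X.tgt (Quotient.out ε)) *
      ((translator K (X.tgt (Quotient.out ε)))⁻¹ * s.1 * translator K (X.tgt (Quotient.out ε))) *
      ((translator K (X.src (Quotient.out ε)))⁻¹ * translator K (X.tgt (Quotient.out ε)))⁻¹ =
      (translator K (X.src (Quotient.out ε)))⁻¹ * s.1 * translator K (X.src (Quotient.out ε))
    group)

theorem pathGroupHom_vertexElem {v : orbitRel.Quotient K X.V} {g : K}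
    (hg : g ∈ stabilizer K v.out) : hX.pathGroupHom (hX.vertexElem v g) = g := by
  rw [hX.vertexElem_of_mem hg]
  exact GraphOfGroups.pathGroupLift_preVertex (𝒢 := quotientGraphOfGroups hX) ..

theorem pathGroupHom_edgeElem (ε : orbitRel.Quotient K X.E) :
    hX.pathGroupHom (hX.edgeElem ε) =
      (translator K (X.src ε.out))⁻¹ * translator K (X.tgt ε.out) :=
  GraphOfGroups.pathGroupLift_preEdge (𝒢 := quotientGraphOfGroups hX) ..

/-- For `x` and `k`, the element of the group at the orbit of `x` which measures how far `k` is
from respecting the chosen translating elements at `x` and `k • x`. -/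
noncomputable def vertexCocycle (k : K) (x : X.V) : (quotientGraphOfGroups hX).PathGroup :=
  hX.vertexElem (orbitMk K x) ((translator K (k • x))⁻¹ * k * translator K x)

theorem vertexCocycle_mul (k l : K) (x : X.V) :
    hX.vertexCocycle (k * l) x = hX.vertexCocycle k (l • x) * hX.vertexCocycle l x := by
  have h := translator_smul_inv_mul_mem k (l • x)
  rw [orbitMk_smul] at h
  rw [vertexCocycle, vertexCocycle, vertexCocycle, orbitMk_smul,
    ← hX.vertexElem_mul h (translator_smul_inv_mul_mem l x), mul_smul]
  group

theorem pathGroupHom_vertexCocycle (k : K) (x : X.V) :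
    hX.pathGroupHom (hX.vertexCocycle k x) = (translator K (k • x))⁻¹ * k * translator K x :=
  hX.pathGroupHom_vertexElem (translator_smul_inv_mul_mem k x)

/-- The label of the edge `b • ε.out` of `X` in the path group. -/
noncomputable def edgeLabel (ε : orbitRel.Quotient K X.E) (b : K) :
    (quotientGraphOfGroups hX).PathGroup :=
  hX.vertexCocycle b (X.src ε.out) * hX.edgeElem ε * (hX.vertexCocycle b (X.tgt ε.out))⁻¹

theorem edgeLabel_mul (ε : orbitRel.Quotient K X.E) (k b : K) :
    hX.edgeLabel ε (k * b) = hX.vertexCocycle k (b • X.src ε.out) * hX.edgeLabel ε b *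
      (hX.vertexCocycle k (b • X.tgt ε.out))⁻¹ := by
  simp only [edgeLabel, vertexCocycle_mul]
  group

theorem edgeLabel_of_mem {ε : orbitRel.Quotient K X.E} {s : K} (hs : s ∈ stabilizer K ε.out) :
    hX.edgeLabel ε s = hX.edgeElem ε := by
  have h₁ : s • X.src ε.out = X.src ε.out := by
    rw [← hX.src_smul, mem_stabilizer_iff.1 hs]
  have h₂ : s • X.tgt ε.out = X.tgt ε.out := by
    rw [← hX.tgt_smul, mem_stabilizer_iff.1 hs]
  rw [edgeLabel, vertexCocycle, vertexCocycle, h₁, h₂, ← hX.edgeElem_relation hs]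
  group

theorem edgeLabel_eq_of_smul_eq {ε : orbitRel.Quotient K X.E} {b b' : K}
    (h : b • ε.out = b' • ε.out) : hX.edgeLabel ε b = hX.edgeLabel ε b' := by
  have hs : b'⁻¹ * b ∈ stabilizer K ε.out := by
    rw [mem_stabilizer_iff, mul_smul, h, inv_smul_smul]
  have h₁ : b • X.src ε.out = b' • X.src ε.out := by
    rw [← hX.src_smul, h, hX.src_smul]
  have h₂ : b • X.tgt ε.out = b' • X.tgt ε.out := by
    rw [← hX.tgt_smul, h, hX.tgt_smul]
  have h₃ := hX.edgeLabel_mul ε b' (b'⁻¹ * b)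
  rw [mul_inv_cancel_left, hX.edgeLabel_of_mem hs, mul_smul, mul_smul, h₁, h₂, inv_smul_smul,
    inv_smul_smul] at h₃
  exact h₃

/-- The cochain on the edges of `X` with values in the path group. It does not depend on the
element translating the representative to the edge (`cochain_smul_out`), it is equivariant up to
the vertex cocycle (`cochain_smul`), and its image in `K` is a coboundary
(`pathGroupHom_cochain`). -/
noncomputable def cochain (e : X.E) : (quotientGraphOfGroups hX).PathGroup :=
  hX.edgeLabel (orbitMk K e) (translator K e)

theorem cochain_smul_out (ε : orbitRel.Quotient K X.E) (b : K) :
    hX.cochain (b • ε.out) = hX.edgeLabel ε b := by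
  have h₁ : orbitMk K (b • ε.out) = ε := by rw [orbitMk_smul, orbitMk_out]
  have h₂ := translator_smul (K := K) (b • ε.out)
  rw [h₁] at h₂
  rw [cochain, h₁]
  exact hX.edgeLabel_eq_of_smul_eq h₂

theorem cochain_smul (k : K) (e : X.E) :
    hX.cochain (k • e) = hX.vertexCocycle k (X.src e) * hX.cochain e *
      (hX.vertexCocycle k (X.tgt e))⁻¹ := by
  have he := translator_smul (K := K) e
  have h₁ : k • e = (k * translator K e) • (orbitMk K e).out := by rw [mul_smul, he]
  have h₂ : X.src e = translator K e • X.src (orbitMk K e).out := by rw [← hX.src_smul, he]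
  have h₃ : X.tgt e = translator K e • X.tgt (orbitMk K e).out := by rw [← hX.tgt_smul, he]
  rw [h₁, hX.cochain_smul_out, hX.edgeLabel_mul, ← h₂, ← h₃]
  rfl

theorem pathGroupHom_cochain (e : X.E) :
    hX.pathGroupHom (hX.cochain e) = (translator K (X.src e))⁻¹ * translator K (X.tgt e) := by
  have he := translator_smul (K := K) e
  have h₂ : X.src e = translator K e • X.src (orbitMk K e).out := by rw [← hX.src_smul, he]
  have h₃ : X.tgt e = translator K e • X.tgt (orbitMk K e).out := by rw [← hX.tgt_smul, he]
  simp only [cochain, edgeLabel, map_mul, map_inv, pathGroupHom_vertexCocycle,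
    pathGroupHom_edgeElem]
  rw [← h₂, ← h₃]
  group

theorem orbitMk_src_out (hX : OrientedGraph.IsAction K X) (e : X.E) :
    orbitMk K (X.src (orbitMk K e).out) = orbitMk K (X.src e) := by
  conv_rhs => rw [← translator_smul (K := K) e, hX.src_smul, orbitMk_smul]

theorem orbitMk_tgt_out (hX : OrientedGraph.IsAction K X) (e : X.E) :
    orbitMk K (X.tgt (orbitMk K e).out) = orbitMk K (X.tgt e) := by
  conv_rhs => rw [← translator_smul (K := K) e, hX.tgt_smul, orbitMk_smul]

theorem isPathElement_vertexElem {v : orbitRel.Quotient K X.V} {g : K}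
    (hg : g ∈ stabilizer K v.out) :
    (quotientGraphOfGroups hX).IsPathElement v v (hX.vertexElem v g) := by
  rw [hX.vertexElem_of_mem hg]
  exact .vertex (𝒢 := quotientGraphOfGroups hX) v ⟨g, hg⟩

theorem isPathElement_vertexCocycle (k : K) (x : X.V) :
    (quotientGraphOfGroups hX).IsPathElement (orbitMk K x) (orbitMk K x)
      (hX.vertexCocycle k x) :=
  hX.isPathElement_vertexElem (translator_smul_inv_mul_mem k x)

theorem isPathElement_cochain (e : X.E) :
    (quotientGraphOfGroups hX).IsPathElement (orbitMk K (X.src e)) (orbitMk K (X.tgt e))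
      (hX.cochain e) := by
  rw [← hX.orbitMk_src_out, ← hX.orbitMk_tgt_out]
  exact ((hX.isPathElement_vertexCocycle _ _).mul
    (.edge (𝒢 := quotientGraphOfGroups hX) (orbitMk K e))).mul
      (hX.isPathElement_vertexCocycle _ _).inv

theorem quotient_connected [Nonempty X.V] (hc : X.IsPreconnected) :
    (quotientGraphOfGroups hX).toSimpleGraph.Connected := by
  obtain ⟨x₀⟩ := ‹Nonempty X.V›
  have key : ∀ x y, (quotientGraphOfGroups hX).toSimpleGraph.Reachable
      (orbitMk K x) (orbitMk K y) := fun x y => by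
    refine hc (fun z => (quotientGraphOfGroups hX).toSimpleGraph.Reachable
      (orbitMk K x) (orbitMk K z)) (fun e => ?_) x y (SimpleGraph.Reachable.refl _)
    have he : (quotientGraphOfGroups hX).toSimpleGraph.Reachable
        (orbitMk K (X.src e)) (orbitMk K (X.tgt e)) := by
      rw [← hX.orbitMk_src_out, ← hX.orbitMk_tgt_out]
      exact reachable_src_tgt (X := (quotientGraphOfGroups hX).toOrientedGraph) (orbitMk K e)
    exact ⟨fun H => H.trans he, fun H => H.trans he.symm⟩
  have : Nonempty (quotientGraphOfGroups hX).V := ⟨orbitMk K x₀⟩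
  refine ⟨fun v w => ?_⟩
  induction v using Quotient.inductionOn with | _ x =>
  induction w using Quotient.inductionOn with | _ y => exact key x y

end OrientedGraph.IsAction

/-! ### The structure theorem for groups acting on graphs with potentials -/

namespace OrientedGraph.IsAction

open MulAction

variable {K : Type u} [Group K] {X : OrientedGraph.{u}} [MulAction K X.V] [MulAction K X.E]
  (hX : OrientedGraph.IsAction K X)

/-- For `k` in `K`, the function `x ↦ Φ (k • x) * vertexCocycle k x` is again a potential of the
cochain, so it is the translate of `Φ` by a constant `ρ k` on the left, and `ρ` is a
homomorphism. -/
theorem exists_hom_of_potential (hc : X.IsPreconnected)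
    {Φ : X.V → (quotientGraphOfGroups hX).PathGroup}
    (hΦ : ∀ e, Φ (X.tgt e) = Φ (X.src e) * hX.cochain e) (x₀ : X.V) :
    ∃ ρ : K →* (quotientGraphOfGroups hX).PathGroup,
      ∀ k x, Φ (k • x) * hX.vertexCocycle k x = ρ k * Φ x := by
  have key : ∀ k x y, Φ (k • y) * hX.vertexCocycle k y * (Φ y)⁻¹ =
      Φ (k • x) * hX.vertexCocycle k x * (Φ x)⁻¹ := fun k x y => by
    refine hc.mul_inv_eq (Ψ := fun z => Φ (k • z) * hX.vertexCocycle k z) hΦ (fun e => ?_) x y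
    rw [← hX.tgt_smul, hΦ, hX.cochain_smul, hX.src_smul]
    group
  have spec : ∀ k x, Φ (k • x) * hX.vertexCocycle k x =
      Φ (k • x₀) * hX.vertexCocycle k x₀ * (Φ x₀)⁻¹ * Φ x := fun k x => by
    rw [← key k x₀ x, inv_mul_cancel_right]
  refine ⟨MonoidHom.mk' (fun k => Φ (k • x₀) * hX.vertexCocycle k x₀ * (Φ x₀)⁻¹) ?_, spec⟩
  intro k l
  rw [mul_smul, hX.vertexCocycle_mul, ← mul_assoc, spec k (l • x₀)]
  group

/-- The homomorphism `ρ` given by a potential is a right inverse of `pathGroupHom`, takes values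
in the fundamental group, and is inverse to `pathGroupHom` there. -/
theorem nonempty_mulEquiv_fundamentalGroup (hc : X.IsPreconnected) (hp : X.HasPotentials)
    (v : (quotientGraphOfGroups hX).V) :
    Nonempty (K ≃* (quotientGraphOfGroups hX).fundamentalGroup v) := by
  obtain ⟨x₀, hx₀⟩ : ∃ x₀ : X.V, x₀ = Quotient.out (s := orbitRel K X.V) v := ⟨_, rfl⟩
  have hx₀v : orbitMk K x₀ = v := by rw [hx₀]; exact orbitMk_out _
  have htr : ∀ w : orbitRel.Quotient K X.V,
      translator K w.out ∈ stabilizer K w.out := translator_out_mem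
  -- The potential is normalized so that it projects to the translating elements in `K`.
  obtain ⟨Φ, hΦ, hΦ₀⟩ : ∃ Φ : X.V → (quotientGraphOfGroups hX).PathGroup,
      (∀ e, Φ (X.tgt e) = Φ (X.src e) * hX.cochain e) ∧
        Φ x₀ = hX.vertexElem v (translator K x₀) := by
    obtain ⟨Φ, hΦ⟩ := hp _ hX.cochain
    refine ⟨fun x => hX.vertexElem v (translator K x₀) * (Φ x₀)⁻¹ * Φ x, fun e => ?_, ?_⟩
    · simp only [hΦ e, mul_assoc]
    · simp only [inv_mul_cancel_right]
  have htr₀ : translator K x₀ ∈ stabilizer K (Quotient.out (s := orbitRel K X.V) v) := by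
    rw [hx₀]; exact htr v
  obtain ⟨ρ, hρ⟩ := hX.exists_hom_of_potential hc hΦ x₀
  have hπΦ : ∀ x, hX.pathGroupHom (Φ x) = translator K x := fun x => by
    have := hc.mul_inv_eq (Φ := fun x => translator K x) (Ψ := fun x => hX.pathGroupHom (Φ x))
      (c := fun e => hX.pathGroupHom (hX.cochain e))
      (fun e => by simp only [hX.pathGroupHom_cochain]; group)
      (fun e => by simp only [hΦ, map_mul]) x₀ x
    simp only [hΦ₀, hX.pathGroupHom_vertexElem htr₀, mul_inv_cancel] at this
    exact mul_inv_eq_one.1 this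
  have hπρ : ∀ k, hX.pathGroupHom (ρ k) = k := fun k => by
    have := congrArg hX.pathGroupHom (hρ k x₀)
    simp only [map_mul, hπΦ, hX.pathGroupHom_vertexCocycle] at this
    rw [← mul_inv_eq_iff_eq_mul.2 this]
    group
  have hpath : ∀ x, (quotientGraphOfGroups hX).IsPathElement v (orbitMk K x) (Φ x) := fun x => by
    refine hc (fun x => (quotientGraphOfGroups hX).IsPathElement v (orbitMk K x) (Φ x))
      (fun e => ⟨fun H => ?_, fun H => ?_⟩) x₀ x ?_
    · rw [hΦ]
      exact H.mul (hX.isPathElement_cochain e)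
    · rw [hΦ] at H
      have := H.mul (hX.isPathElement_cochain e).inv
      rwa [mul_inv_cancel_right] at this
    · rw [hΦ₀, hx₀v]
      exact hX.isPathElement_vertexElem htr₀
  have hρmem : ∀ k, ρ k ∈ (quotientGraphOfGroups hX).fundamentalGroup v := fun k => by
    have h₁ := hpath (k • x₀)
    rw [orbitMk_smul] at h₁
    have h₂ := (h₁.mul (hX.isPathElement_vertexCocycle k x₀)).mul (hpath x₀).inv
    rw [hρ, mul_inv_cancel_right] at h₂
    exact h₂
  -- The element of the path group carried by a path is recovered from its image in `K`, up to
  -- a gauge transformation `Ψ` at its two ends.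
  let Ψ : orbitRel.Quotient K X.V → (quotientGraphOfGroups hX).PathGroup :=
    fun w => Φ w.out * (hX.vertexElem w (translator K w.out))⁻¹
  have hΨ₀ : Ψ v = 1 := by
    simp only [Ψ]
    rw [← hx₀, hΦ₀, mul_inv_cancel]
  have hρv : ∀ w : orbitRel.Quotient K X.V, ∀ g ∈ stabilizer K w.out,
      ρ g = Ψ w * hX.vertexElem w g * (Ψ w)⁻¹ := fun w g hg => by
    have h := hρ g w.out
    rw [vertexCocycle, orbitMk_out, mem_stabilizer_iff.1 hg,
      hX.vertexElem_mul (mul_mem (inv_mem (htr w)) hg) (htr w),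
      hX.vertexElem_mul (inv_mem (htr w)) hg, hX.vertexElem_inv (htr w)] at h
    rw [← mul_inv_eq_iff_eq_mul.2 h]
    simp only [Ψ]
    group
  have hρt : ∀ x, ρ (translator K x) = Φ x * (Ψ (orbitMk K x))⁻¹ := fun x => by
    have h := hρ (translator K x) (orbitMk K x).out
    rw [vertexCocycle, translator_smul, orbitMk_out, inv_mul_cancel, one_mul] at h
    rw [← mul_inv_eq_iff_eq_mul.2 h]
    simp only [Ψ]
    group
  have hρe : ∀ ε : orbitRel.Quotient K X.E,
      ρ ((translator K (X.src ε.out))⁻¹ * translator K (X.tgt ε.out)) =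
        Ψ (orbitMk K (X.src ε.out)) * hX.edgeElem ε * (Ψ (orbitMk K (X.tgt ε.out)))⁻¹ :=
    fun ε => by
      have h : hX.cochain ε.out = hX.edgeElem ε := by
        have := hX.cochain_smul_out ε 1
        rwa [one_smul, hX.edgeLabel_of_mem (one_mem _)] at this
      rw [map_mul, map_inv, hρt, hρt, hΦ, h]
      group
  have hρπ : ∀ (u w : (quotientGraphOfGroups hX).V) (y),
      (quotientGraphOfGroups hX).IsPathElement u w y →
        ρ (hX.pathGroupHom y) = Ψ u * y * (Ψ w)⁻¹ := by
    intro u w y hy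
    induction hy with
    | vertex w g =>
      have := hX.vertexElem_of_mem (v := w) g.2
      have h₂ : hX.pathGroupHom (QuotientGroup.mk
          ((quotientGraphOfGroups hX).preVertex (v := w) g)) = g.1 := by
        rw [← hX.pathGroupHom_vertexElem g.2, this]; rfl
      rw [h₂, hρv w g.1 g.2, this]; rfl
    | edge ε =>
      exact (congrArg ρ (hX.pathGroupHom_edgeElem ε)).trans (hρe ε)
    | inv _ ih => rw [map_inv, map_inv, ih]; group
    | mul _ _ ih₁ ih₂ => rw [map_mul, map_mul, ih₁, ih₂]; group
  refine ⟨MulEquiv.ofBijective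
    (ρ.codRestrict ((quotientGraphOfGroups hX).fundamentalGroup v) hρmem) ⟨?_, ?_⟩⟩
  · intro k l hkl
    have : ρ k = ρ l := congrArg Subtype.val hkl
    rw [← hπρ k, this, hπρ]
  · rintro ⟨y, hy⟩
    refine ⟨hX.pathGroupHom y, Subtype.ext ?_⟩
    have := hρπ v v y hy
    rwa [hΨ₀, one_mul, inv_one, mul_one] at this

/-- The structure theorem of Bass–Serre theory, for an action without inversions on a connected
graph all of whose cochains have potentials. -/
theorem isDecompositionOf [Nonempty X.V] (hc : X.IsPreconnected) (hp : X.HasPotentials) :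
    (quotientGraphOfGroups hX).IsDecompositionOf K :=
  ⟨hX.quotient_connected hc, hX.nonempty_mulEquiv_fundamentalGroup hc hp⟩

end OrientedGraph.IsAction

/-! ### Orbits and stabilizers of the kernel of a character -/

section KernelAction

open MulAction

variable {G L N : Type*} [Group G] [Group L] [CommGroup N] (f : G →* N)

/-- The orbits of `ker f` on the cosets of `S` correspond to the cosets of `f(S)` in `f(G)`. -/
theorem nonempty_orbitRel_quotient_ker_equiv (S : Subgroup G) :
    Nonempty (orbitRel.Quotient f.ker (G ⧸ S) ≃ f.range ⧸ (S.map f).subgroupOf f.range) := by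
  let T : G ⧸ S → f.range ⧸ (S.map f).subgroupOf f.range := fun x =>
    Quotient.liftOn' x (fun g => (f.rangeRestrict g : f.range ⧸ (S.map f).subgroupOf f.range))
      (by
        intro g g' hg
        rw [QuotientGroup.leftRel_apply] at hg
        refine QuotientGroup.eq.2 ?_
        rw [Subgroup.mem_subgroupOf]
        exact ⟨g⁻¹ * g', hg, by simp⟩)
  have hT : ∀ g : G, T g = (f.rangeRestrict g : f.range ⧸ (S.map f).subgroupOf f.range) :=
    fun g => rfl
  have hTs : ∀ x y : G ⧸ S, (orbitRel f.ker (G ⧸ S)) x y → T x = T y := by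
    rintro x y ⟨k, rfl⟩
    induction y using Quotient.inductionOn with | _ g =>
    change T ((k * g : G) : G ⧸ S) = T (g : G ⧸ S)
    rw [hT, hT]
    congr 1
    ext
    simp [MonoidHom.mem_ker.1 k.2]
  refine ⟨Equiv.ofBijective (Quotient.lift T hTs) ⟨?_, ?_⟩⟩
  · intro x y hxy
    induction x using Quotient.inductionOn with | _ x =>
    induction y using Quotient.inductionOn with | _ y =>
    induction x using Quotient.inductionOn with | _ g =>
    induction y using Quotient.inductionOn with | _ g' =>
    have h := QuotientGroup.eq.1 (hxy : T (g : G ⧸ S) = T (g' : G ⧸ S))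
    rw [Subgroup.mem_subgroupOf] at h
    obtain ⟨s, hs, hfs⟩ := h
    have hfs : f s = (f g)⁻¹ * f g' := hfs
    refine Quotient.sound (s := orbitRel f.ker (G ⧸ S)) ⟨⟨g * s * g'⁻¹, ?_⟩, ?_⟩
    · rw [MonoidHom.mem_ker, map_mul, map_mul, hfs, map_inv]
      group
    · change ((g * s * g'⁻¹ * g' : G) : G ⧸ S) = g
      rw [inv_mul_cancel_right]
      exact QuotientGroup.mk_mul_of_mem g hs
  · intro y
    induction y using Quotient.inductionOn with | _ y =>
    obtain ⟨_, g, rfl⟩ := y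
    exact ⟨Quotient.mk (orbitRel f.ker (G ⧸ S)) (g : G ⧸ S), rfl⟩

/-- The stabilizer in `ker f` of the coset `gS` is conjugate to `ker f ∩ S`. -/
theorem nonempty_stabilizer_ker_mulEquiv {i : L →* G} (hi : Function.Injective i)
    (x : G ⧸ i.range) : Nonempty (stabilizer f.ker x ≃* (f.comp i).ker) := by
  induction x using Quotient.inductionOn with | _ g =>
  have hmem : ∀ l : (f.comp i).ker, g * i l * g⁻¹ ∈ f.ker := fun l => by
    have hl : f (i l) = 1 := l.2
    rw [MonoidHom.mem_ker, map_mul, map_mul, hl, map_inv]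
    group
  have hstab : ∀ l : (f.comp i).ker,
      (⟨g * i l * g⁻¹, hmem l⟩ : f.ker) ∈ stabilizer f.ker (g : G ⧸ i.range) := fun l => by
    change ((g * i l * g⁻¹ * g : G) : G ⧸ i.range) = g
    rw [inv_mul_cancel_right]
    exact QuotientGroup.mk_mul_of_mem g ⟨l, rfl⟩
  let F : (f.comp i).ker →* stabilizer f.ker (g : G ⧸ i.range) :=
    MonoidHom.mk' (fun l => ⟨⟨g * i l * g⁻¹, hmem l⟩, hstab l⟩) (fun l m => by
      refine Subtype.ext (Subtype.ext ?_)
      simp only [Subgroup.coe_mul, map_mul]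
      group)
  refine ⟨(MulEquiv.ofBijective F ⟨?_, ?_⟩).symm⟩
  · intro l m hlm
    have h : g * i l * g⁻¹ = g * i m * g⁻¹ := congrArg (fun s => ((s.1 : f.ker) : G)) hlm
    exact Subtype.ext (hi (by simpa using h))
  · rintro ⟨⟨k, hk⟩, hs⟩
    have hs : ((k * g : G) : G ⧸ i.range) = g := hs
    obtain ⟨l, hl⟩ := QuotientGroup.eq.1 hs.symm
    refine ⟨⟨l, ?_⟩, Subtype.ext (Subtype.ext ?_)⟩
    · rw [MonoidHom.mem_ker, MonoidHom.comp_apply, hl, map_mul, map_mul, MonoidHom.mem_ker.1 hk,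
        map_inv]
      group
    · change g * i l * g⁻¹ = k
      rw [hl]
      group

end KernelAction

section Vertices

open MulAction

variable {G : Type u} [Group G] (K : Subgroup G) {A B C : Subgroup G} (hA : C ≤ A) (hB : C ≤ B)

/-- The vertex `gA` of the Bass–Serre graph. -/
def leftVertex (x : G ⧸ A) : (bassSerreGraph hA hB).V := Sum.inl x

/-- The vertex `gB` of the Bass–Serre graph. -/
def rightVertex (x : G ⧸ B) : (bassSerreGraph hA hB).V := Sum.inr x

/-- The orbits of `K` on the vertices of the form `gA`. -/
def leftOrbits : Set (orbitRel.Quotient K (bassSerreGraph hA hB).V) :=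
  Set.range fun x => orbitMk K (leftVertex hA hB x)

/-- The orbits of `K` on the vertices of the form `gB`. -/
def rightOrbits : Set (orbitRel.Quotient K (bassSerreGraph hA hB).V) :=
  Set.range fun x => orbitMk K (rightVertex hA hB x)

theorem isCompl_leftOrbits_rightOrbits :
    IsCompl (leftOrbits K hA hB) (rightOrbits K hA hB) := by
  refine eq_compl_iff_isCompl.1 ?_
  ext v
  induction v using Quotient.inductionOn with | _ v =>
  constructor
  · rintro ⟨x, hx⟩ ⟨y, hy⟩
    obtain ⟨k, hk⟩ := Quotient.exact (hx.trans hy.symm)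
    exact Sum.inr_ne_inl (hk : Sum.inr (k • y) = Sum.inl x)
  · intro hv
    rcases v with x | x
    · exact ⟨x, rfl⟩
    · exact absurd ⟨x, rfl⟩ hv

theorem encard_leftOrbits :
    (leftOrbits K hA hB).encard = ENat.card (orbitRel.Quotient K (G ⧸ A)) := by
  let j : orbitRel.Quotient K (G ⧸ A) → orbitRel.Quotient K (bassSerreGraph hA hB).V :=
    Quotient.map (leftVertex hA hB) (by
      rintro x y ⟨k, rfl⟩
      exact ⟨k, rfl⟩)
  have hj : Function.Injective j := by
    intro x y hxy
    induction x using Quotient.inductionOn with | _ x =>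
    induction y using Quotient.inductionOn with | _ y =>
    obtain ⟨k, hk⟩ := Quotient.exact hxy
    exact Quotient.sound ⟨k, Sum.inl_injective hk⟩
  have hr : leftOrbits K hA hB = Set.range j := by
    ext v
    constructor
    · rintro ⟨x, rfl⟩
      exact ⟨orbitMk K x, rfl⟩
    · rintro ⟨x, rfl⟩
      induction x using Quotient.inductionOn with | _ x => exact ⟨x, rfl⟩
  rw [hr, ← Set.image_univ, hj.encard_image, Set.encard_univ]

theorem encard_rightOrbits :
    (rightOrbits K hA hB).encard = ENat.card (orbitRel.Quotient K (G ⧸ B)) := by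
  let j : orbitRel.Quotient K (G ⧸ B) → orbitRel.Quotient K (bassSerreGraph hA hB).V :=
    Quotient.map (rightVertex hA hB) (by
      rintro x y ⟨k, rfl⟩
      exact ⟨k, rfl⟩)
  have hj : Function.Injective j := by
    intro x y hxy
    induction x using Quotient.inductionOn with | _ x =>
    induction y using Quotient.inductionOn with | _ y =>
    obtain ⟨k, hk⟩ := Quotient.exact hxy
    exact Quotient.sound ⟨k, Sum.inr_injective hk⟩
  have hr : rightOrbits K hA hB = Set.range j := by
    ext v
    constructor
    · rintro ⟨x, rfl⟩
      exact ⟨orbitMk K x, rfl⟩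
    · rintro ⟨x, rfl⟩
      induction x using Quotient.inductionOn with | _ x => exact ⟨x, rfl⟩
  rw [hr, ← Set.image_univ, hj.encard_image, Set.encard_univ]

theorem exists_stabilizer_out_eq_of_mem_leftOrbits
    {v : orbitRel.Quotient K (bassSerreGraph hA hB).V} (hv : v ∈ leftOrbits K hA hB) :
    ∃ x : G ⧸ A, stabilizer K v.out = stabilizer K x := by
  obtain ⟨x, rfl⟩ := hv
  obtain ⟨k, hk⟩ := Quotient.exact (orbitMk_out (orbitMk K (leftVertex hA hB x)))
  refine ⟨k • x, ?_⟩
  rw [← hk]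
  ext l
  exact Sum.inl_injective.eq_iff (a := l • (k • x)) (b := k • x)

theorem exists_stabilizer_out_eq_of_mem_rightOrbits
    {v : orbitRel.Quotient K (bassSerreGraph hA hB).V} (hv : v ∈ rightOrbits K hA hB) :
    ∃ x : G ⧸ B, stabilizer K v.out = stabilizer K x := by
  obtain ⟨x, rfl⟩ := hv
  obtain ⟨k, hk⟩ := Quotient.exact (orbitMk_out (orbitMk K (rightVertex hA hB x)))
  refine ⟨k • x, ?_⟩
  rw [← hk]
  ext l
  exact Sum.inr_injective.eq_iff (a := l • (k • x)) (b := k • x)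

/-- Every vertex of the Bass–Serre graph is an end of an edge. -/
theorem finite_orbits_vertices [Finite (orbitRel.Quotient K (bassSerreGraph hA hB).E)] :
    Finite (orbitRel.Quotient K (bassSerreGraph hA hB).V) := by
  let s : orbitRel.Quotient K (bassSerreGraph hA hB).E ⊕
      orbitRel.Quotient K (bassSerreGraph hA hB).E →
        orbitRel.Quotient K (bassSerreGraph hA hB).V :=
    Sum.elim
      (Quotient.map (bassSerreGraph hA hB).src (by
        rintro x y ⟨k, rfl⟩
        exact ⟨k, ((bassSerreGraph_isAction K hA hB).src_smul k y).symm⟩))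
      (Quotient.map (bassSerreGraph hA hB).tgt (by
        rintro x y ⟨k, rfl⟩
        exact ⟨k, ((bassSerreGraph_isAction K hA hB).tgt_smul k y).symm⟩))
  refine Finite.of_surjective s fun v => ?_
  induction v using Quotient.inductionOn with | _ v =>
  rcases v with x | x
  · induction x using Quotient.inductionOn with | _ g =>
    exact ⟨Sum.inl (orbitMk K (α := (bassSerreGraph hA hB).E) (g : G ⧸ C)), rfl⟩
  · induction x using Quotient.inductionOn with | _ g =>
    exact ⟨Sum.inr (orbitMk K (α := (bassSerreGraph hA hB).E) (g : G ⧸ C)), rfl⟩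

end Vertices

/-! ### Discrete characters -/

theorem finite_quotient_of_isCyclic {G : Type*} [Group G] [IsCyclic G] {S : Subgroup G} {s : G}
    (hs : s ∈ S) (hs₁ : s ≠ 1) : Finite (G ⧸ S) := by
  obtain ⟨g, hg⟩ := IsCyclic.exists_generator (α := G)
  obtain ⟨m, rfl⟩ := hg s
  have hm : m ≠ 0 := by
    rintro rfl
    exact hs₁ (zpow_zero g)
  refine Finite.of_surjective
    (fun i : Finset.Ico (0 : ℤ) |m| => ((g ^ (i : ℤ) : G) : G ⧸ S)) fun x => ?_
  induction x using Quotient.inductionOn with | _ x =>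
  obtain ⟨k, rfl⟩ := hg x
  refine ⟨⟨k % m, Finset.mem_Ico.2 ⟨Int.emod_nonneg k hm, Int.emod_lt_abs k hm⟩⟩, ?_⟩
  refine QuotientGroup.eq.2 ?_
  have : (g ^ (k % m))⁻¹ * g ^ k = (g ^ m) ^ (k / m) := by
    rw [← zpow_neg, ← zpow_add, ← zpow_mul]
    congr 1
    have := Int.emod_add_mul_ediv k m
    linarith
  change (g ^ (k % m))⁻¹ * g ^ k ∈ S
  rw [this]
  exact S.zpow_mem hs _

/-- A discrete character is, up to an injection of its image, a character with values in `ℤ`. -/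
theorem IsDiscreteCharacter.exists_int {G : Type u} [Group G] {f : G →* Multiplicative ℝ}
    (hf : IsDiscreteCharacter f) :
    ∃ χ : G →* Multiplicative ℤ, (∀ g, χ g = 1 ↔ f g = 1) ∧ ∃ g, χ g ≠ 1 := by
  have := hf.1
  have := hf.2
  let e : Multiplicative ℤ ≃* f.range := intCyclicMulEquiv
  have key : ∀ g, e.symm (f.rangeRestrict g) = 1 ↔ f g = 1 := fun g => by
    rw [EmbeddingLike.map_eq_one_iff]
    exact Subtype.ext_iff
  refine ⟨e.symm.toMonoidHom.comp f.rangeRestrict, key, ?_⟩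
  obtain ⟨⟨_, g, rfl⟩, hg⟩ := exists_ne (1 : f.range)
  exact ⟨g, fun h => hg (Subtype.ext ((key g).1 h))⟩

/-! ### Surjections onto a free group of infinite rank -/

section Shift

/-- The action of `ℤ` by shifts on the free group on the set `ℤ`. -/
def shift : Multiplicative ℤ →* MulAut (FreeGroup ℤ) where
  toFun n := FreeGroup.freeGroupCongr (Equiv.addLeft n.toAdd)
  map_one' := by
    refine MulEquiv.toMonoidHom_injective (FreeGroup.ext_hom _ _ fun i => ?_)
    simp
  map_mul' m n := by
    refine MulEquiv.toMonoidHom_injective (FreeGroup.ext_hom _ _ fun i => ?_)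
    simp [add_assoc]

theorem shift_of (n : Multiplicative ℤ) (i : ℤ) :
    shift n (FreeGroup.of i) = FreeGroup.of (n.toAdd + i) := by
  simp [shift]

open SemidirectProduct

/-- The conjugate of the generator `x_0` by the `n`-th power of the stable letter is `x_n`. -/
theorem inr_mul_inl_mul_inr_inv (n : Multiplicative ℤ) (i : ℤ) :
    (inr n * inl (FreeGroup.of i) * (inr n)⁻¹ : FreeGroup ℤ ⋊[shift] Multiplicative ℤ) =
      inl (FreeGroup.of (n.toAdd + i)) := by
  ext <;> simp [shift_of]

/-- A homomorphism to `FreeGroup ℤ ⋊ ℤ` restricts to a homomorphism to `FreeGroup ℤ` on the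
kernel of its composition with the projection to `ℤ`. -/
def leftHom {G : Type*} [Group G] (θ : G →* FreeGroup ℤ ⋊[shift] Multiplicative ℤ)
    (K : Subgroup G) (hK : ∀ k ∈ K, (θ k).right = 1) : K →* FreeGroup ℤ :=
  MonoidHom.mk' (fun k => (θ k).left) fun k l => by
    simp [hK k k.2]

/-- The homomorphism of free groups which sends `x_{c(k+1)}` to the generator `k`, and every other
generator to `1`; in particular it kills `x_0`. -/
noncomputable def sparseHom (c : ℤ) : FreeGroup ℤ →* FreeGroup ℕ :=
  FreeGroup.lift (Function.extend (fun k : ℕ => c * (k + 1)) FreeGroup.of 1)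

theorem sparseHom_of {c : ℤ} (hc : c ≠ 0) (k : ℕ) :
    sparseHom c (FreeGroup.of (c * (k + 1))) = FreeGroup.of k := by
  have hinj : Function.Injective fun k : ℕ => c * ((k : ℤ) + 1) := fun k l hkl => by
    simpa [hc] using hkl
  rw [sparseHom, FreeGroup.lift_apply_of]
  exact hinj.extend_apply _ _ _

theorem sparseHom_of_zero {c : ℤ} (hc : c ≠ 0) : sparseHom c (FreeGroup.of 0) = 1 := by
  rw [sparseHom, FreeGroup.lift_apply_of, Function.extend_apply']
  · rfl
  · rintro ⟨k, hk⟩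
    have : (k : ℤ) + 1 ≠ 0 := by positivity
    exact mul_ne_zero hc this hk

theorem surjective_of_forall_of_mem_range {G : Type*} [Group G] {φ : G →* FreeGroup ℕ}
    (h : ∀ k, FreeGroup.of k ∈ φ.range) : Function.Surjective φ := by
  rw [← MonoidHom.range_eq_top, eq_top_iff, ← FreeGroup.closure_range_of, Subgroup.closure_le]
  rintro _ ⟨k, rfl⟩
  exact h k

end Shift

namespace IsSplitting

open RAAG SemidirectProduct

variable {V : Type u} {Γ : SimpleGraph V} {Γ₁ Γ₂ Γ₃ : Γ.Subgraph}

theorem exists_hom_of_commute (h : IsSplitting Γ₁ Γ₂ Γ₃) {H : Type*} [Group H] (s t : V → H)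
    (hs : ∀ v ∈ Γ₁.verts, ∀ w ∈ Γ₁.verts, Commute (s v) (s w))
    (ht : ∀ v ∈ Γ₂.verts, ∀ w ∈ Γ₂.verts, Commute (t v) (t w))
    (hst : ∀ v ∈ Γ₃.verts, s v = t v) :
    ∃ θ : RAAG Γ →* H, (∀ v ∈ Γ₁.verts, θ (of Γ v) = s v) ∧
      ∀ v ∈ Γ₂.verts, θ (of Γ v) = t v := by
  obtain ⟨θ, h₁, h₂⟩ := h.exists_hom
    (RAAG.lift (Γ := Γ₁.coe) (fun v => s v) fun v w _ => hs v v.2 w w.2)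
    (RAAG.lift (Γ := Γ₂.coe) (fun v => t v) fun v w _ => ht v v.2 w w.2)
    (RAAG.hom_ext fun v => by
      simp only [MonoidHom.comp_apply, map_of, lift_of]
      exact hst v v.2)
  refine ⟨θ, fun v hv => ?_, fun v hv => ?_⟩
  · have := DFunLike.congr_fun h₁ (of Γ₁.coe ⟨v, hv⟩)
    rwa [MonoidHom.comp_apply, incl_of, lift_of] at this
  · have := DFunLike.congr_fun h₂ (of Γ₂.coe ⟨v, hv⟩)
    rwa [MonoidHom.comp_apply, incl_of, lift_of] at this

/-- Both parts of the splitting have nontrivial image under `χ`: send `v` to `x_0 t^χ(v) x_0⁻¹`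
or to `t^χ(v)` according to the part. Powers of generators `v` of the first and `w` of the second
part with the same value of `χ` differ by elements of the kernel mapping to `x_0 x_n⁻¹`. -/
theorem exists_surjective_of_ne_one_of_ne_one (h : IsSplitting Γ₁ Γ₂ Γ₃)
    {χ : RAAG Γ →* Multiplicative ℤ} (hχ₃ : ∀ v ∈ Γ₃.verts, χ (of Γ v) = 1) {v w : V}
    (hv : v ∈ Γ₁.verts) (hχv : χ (of Γ v) ≠ 1) (hw : w ∈ Γ₂.verts) (hχw : χ (of Γ w) ≠ 1) :
    ∃ φ : χ.ker →* FreeGroup ℕ, Function.Surjective φ := by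
  let x : FreeGroup ℤ ⋊[shift] Multiplicative ℤ := inl (FreeGroup.of 0)
  obtain ⟨θ, hθ₁, hθ₂⟩ := h.exists_hom_of_commute
    (fun v => x * inr (χ (of Γ v)) * x⁻¹) (fun v => inr (χ (of Γ v)))
    (fun v _ w _ => ((Commute.all (χ (of Γ v)) (χ (of Γ w))).map inr).conj x)
    (fun v _ w _ => (Commute.all (χ (of Γ v)) (χ (of Γ w))).map inr)
    (fun v hv => by simp [hχ₃ v hv])
  have hright : rightHom.comp θ = χ := RAAG.hom_ext fun u => by
    rcases h.mem_or_mem u with hu | hu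
    · simp [hθ₁ u hu, x]
    · simp [hθ₂ u hu]
  obtain ⟨m, hm⟩ : ∃ m : ℤ, χ (of Γ v) = Multiplicative.ofAdd m := ⟨_, rfl⟩
  obtain ⟨n, hn⟩ : ∃ n : ℤ, χ (of Γ w) = Multiplicative.ofAdd n := ⟨_, rfl⟩
  have hm₀ : m ≠ 0 := by rintro rfl; exact hχv hm
  have hn₀ : n ≠ 0 := by rintro rfl; exact hχw hn
  have hc : m * n ≠ 0 := mul_ne_zero hm₀ hn₀
  refine ⟨(sparseHom (m * n)).comp
    (leftHom θ χ.ker fun k hk => (DFunLike.congr_fun hright k).trans hk),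
    surjective_of_forall_of_mem_range fun k => ?_⟩
  rw [← inv_mem_iff]
  have hker : of Γ v ^ (n * (k + 1)) * (of Γ w ^ (m * (k + 1)))⁻¹ ∈ χ.ker := by
    rw [MonoidHom.mem_ker, map_mul, map_inv, map_zpow, map_zpow, hm, hn, ← ofAdd_zsmul,
      ← ofAdd_zsmul, ← ofAdd_neg, ← ofAdd_add, ofAdd_eq_one]
    simp only [smul_eq_mul]
    ring
  refine ⟨⟨_, hker⟩, ?_⟩
  have hθ : θ (of Γ v ^ (n * (k + 1)) * (of Γ w ^ (m * (k + 1)))⁻¹) =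
      inl (FreeGroup.of 0 * (FreeGroup.of (m * n * (k + 1)))⁻¹) := by
    have e : (Multiplicative.ofAdd m) ^ (n * (k + 1) : ℤ) =
        Multiplicative.ofAdd (m * n * (k + 1)) := by
      rw [← ofAdd_zsmul, smul_eq_mul]
      congr 1
      ring
    have e' : (Multiplicative.ofAdd n) ^ (m * (k + 1) : ℤ) =
        Multiplicative.ofAdd (m * n * (k + 1)) := by
      rw [← ofAdd_zsmul, smul_eq_mul]
      congr 1
      ring
    have e'' := inr_mul_inl_mul_inr_inv (Multiplicative.ofAdd (m * n * (k + 1))) 0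
    rw [toAdd_ofAdd, add_zero] at e''
    rw [map_mul, map_inv, map_zpow, map_zpow, hθ₁ v hv, hθ₂ w hw, hm, hn, conj_zpow,
      ← map_zpow inr, ← map_zpow inr, e, e', map_mul inl, map_inv inl, ← e'']
    simp only [x, mul_inv_rev, inv_inv, mul_assoc]
  have hl : leftHom θ χ.ker (fun k hk => (DFunLike.congr_fun hright k).trans hk) ⟨_, hker⟩ =
      FreeGroup.of 0 * (FreeGroup.of (m * n * (k + 1)))⁻¹ :=
    congrArg SemidirectProduct.left hθ
  rw [MonoidHom.comp_apply, hl, map_mul, map_inv, sparseHom_of_zero hc, sparseHom_of hc, one_mul]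

/-- The first part of the splitting lies in the kernel of `χ`: send the generators outside the
second part to `x_0`, and a generator `v` of the second part to `t^χ(v)`. The conjugates of a
generator of the first kind by powers of one of the second kind map to the `x_n`. -/
theorem exists_surjective_of_eq_one (h : IsSplitting Γ₁ Γ₂ Γ₃)
    {χ : RAAG Γ →* Multiplicative ℤ} (hχ₁ : ∀ v ∈ Γ₁.verts, χ (of Γ v) = 1) {w : V}
    (hw : w ∈ Γ₂.verts) (hχw : χ (of Γ w) ≠ 1) :
    ∃ φ : χ.ker →* FreeGroup ℕ, Function.Surjective φ := by
  classical
  obtain ⟨v, hv, hv₂⟩ := h.exists_vertex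
  let x : FreeGroup ℤ ⋊[shift] Multiplicative ℤ := inl (FreeGroup.of 0)
  obtain ⟨θ, hθ₁, hθ₂⟩ := h.exists_hom_of_commute
    (fun v => if v ∈ Γ₂.verts then 1 else x) (fun v => inr (χ (of Γ v)))
    (fun v _ w _ => by split_ifs <;> simp)
    (fun v _ w _ => (Commute.all (χ (of Γ v)) (χ (of Γ w))).map inr)
    (fun v hv => by
      rw [← h.verts_inter] at hv
      simp [hv.2, hχ₁ v hv.1])
  have hright : rightHom.comp θ = χ := RAAG.hom_ext fun u => by
    rcases h.mem_or_mem u with hu | hu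
    · have := hχ₁ u hu
      by_cases hu₂ : u ∈ Γ₂.verts
      · simp [hθ₁ u hu, hu₂, this]
      · simp [hθ₁ u hu, hu₂, this, x]
    · simp [hθ₂ u hu]
  obtain ⟨n, hn⟩ : ∃ n : ℤ, χ (of Γ w) = Multiplicative.ofAdd n := ⟨_, rfl⟩
  have hn₀ : n ≠ 0 := by rintro rfl; exact hχw hn
  refine ⟨(sparseHom n).comp
    (leftHom θ χ.ker fun k hk => (DFunLike.congr_fun hright k).trans hk),
    surjective_of_forall_of_mem_range fun k => ?_⟩
  have hker : of Γ w ^ (k + 1) * of Γ v * (of Γ w ^ (k + 1))⁻¹ ∈ χ.ker := by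
    rw [MonoidHom.mem_ker, map_mul, map_mul, hχ₁ v hv, map_inv, mul_one, mul_inv_cancel]
  refine ⟨⟨_, hker⟩, ?_⟩
  have hθ : θ (of Γ w ^ (k + 1) * of Γ v * (of Γ w ^ (k + 1))⁻¹) =
      inl (FreeGroup.of (n * (k + 1))) := by
    have e : (Multiplicative.ofAdd n) ^ (k + 1) = Multiplicative.ofAdd (n * (k + 1)) := by
      rw [← ofAdd_nsmul, nsmul_eq_mul]
      congr 1
      push_cast
      ring
    have e'' := inr_mul_inl_mul_inr_inv (Multiplicative.ofAdd (n * (k + 1))) 0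
    rw [toAdd_ofAdd, add_zero] at e''
    rw [map_mul, map_mul, map_inv, map_pow, hθ₁ v hv, hθ₂ w hw, if_neg hv₂, ← map_pow, hn, e,
      ← e'']
  have hl : leftHom θ χ.ker (fun k hk => (DFunLike.congr_fun hright k).trans hk) ⟨_, hker⟩ =
      FreeGroup.of (n * (k + 1)) :=
    congrArg SemidirectProduct.left hθ
  rw [MonoidHom.comp_apply, hl, sparseHom_of hn₀]

theorem exists_ker_hom_freeGroup_surjective (h : IsSplitting Γ₁ Γ₂ Γ₃)
    {χ : RAAG Γ →* Multiplicative ℤ} (hχ₃ : ∀ v ∈ Γ₃.verts, χ (of Γ v) = 1)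
    (hχ : ∃ g, χ g ≠ 1) : ∃ φ : χ.ker →* FreeGroup ℕ, Function.Surjective φ := by
  obtain ⟨w, hw⟩ : ∃ w, χ (of Γ w) ≠ 1 := by
    by_contra! hcon
    obtain ⟨g, hg⟩ := hχ
    exact hg (DFunLike.congr_fun (RAAG.hom_ext hcon : χ = 1) g)
  have key : ∀ {Γ₁ Γ₂ : Γ.Subgraph} (_ : IsSplitting Γ₁ Γ₂ Γ₃) (_ : w ∈ Γ₂.verts),
      ∃ φ : χ.ker →* FreeGroup ℕ, Function.Surjective φ := by
    intro Γ₁ Γ₂ h hw₂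
    by_cases h₁ : ∀ v ∈ Γ₁.verts, χ (of Γ v) = 1
    · exact h.exists_surjective_of_eq_one h₁ hw₂ hw
    · push Not at h₁
      obtain ⟨v, hv, hχv⟩ := h₁
      exact h.exists_surjective_of_ne_one_of_ne_one hχ₃ hv hχv hw₂ hw
  rcases h.mem_or_mem w with hw₁ | hw₂
  · exact key h.symm hw₁
  · exact key h hw₂

end IsSplitting

/-! ### Kernels of discrete characters of right-angled Artin groups -/

theorem theorem3p2 {V : Type u} [Finite V] (Γ : SimpleGraph V) (Γ₁ Γ₂ Γ₃ : Γ.Subgraph)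
    (h : IsSplitting Γ₁ Γ₂ Γ₃) (f : RAAG Γ →* Multiplicative ℝ) (hf : IsDiscreteCharacter f) :
    -- `A_Γ` is the amalgamated product of `A_{Γ₁}` and `A_{Γ₂}` over `A_{Γ₃}`
    (Function.Injective (RAAG.map (SimpleGraph.Subgraph.inclusion h.le₁)) ∧
      Function.Injective (RAAG.map (SimpleGraph.Subgraph.inclusion h.le₂)) ∧
      CategoryTheory.IsPushout
        (GrpCat.ofHom (RAAG.map (SimpleGraph.Subgraph.inclusion h.le₁)))
        (GrpCat.ofHom (RAAG.map (SimpleGraph.Subgraph.inclusion h.le₂)))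
        (GrpCat.ofHom (RAAG.incl Γ₁)) (GrpCat.ofHom (RAAG.incl Γ₂))) ∧
    -- its Bass–Serre graph is a tree
    h.bassSerreTree.IsTree ∧
    -- `ker f` splits as the quotient graph of groups of its action on this tree
    (h.kerGraphOfGroups f).IsDecompositionOf f.ker ∧
    -- the vertices and their groups
    (∃ V₁ V₂ : Set (h.kerGraphOfGroups f).V, IsCompl V₁ V₂ ∧
      V₁.encard = RAAG.imageIndex f Γ₁ ∧
      V₂.encard = RAAG.imageIndex f Γ₂ ∧
      (∀ v ∈ V₁, Nonempty ((h.kerGraphOfGroups f).vertexGroup v ≃* (RAAG.restrict f Γ₁).ker)) ∧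
      (∀ v ∈ V₂, Nonempty ((h.kerGraphOfGroups f).vertexGroup v ≃* (RAAG.restrict f Γ₂).ker))) ∧
    -- the edges and their groups
    (ENat.card (h.kerGraphOfGroups f).E = RAAG.imageIndex f Γ₃ ∧
      ∀ e, Nonempty ((h.kerGraphOfGroups f).edgeGroup e ≃* (RAAG.restrict f Γ₃).ker)) ∧
    -- the tame case: the graph of groups is finite
    (RAAG.restrict f Γ₃ ≠ 1 →
      Finite (h.kerGraphOfGroups f).V ∧ Finite (h.kerGraphOfGroups f).E) ∧
    -- the wild case: `ker f` surjects onto the free group of countably infinite rank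
    (RAAG.restrict f Γ₃ = 1 →
      ∃ φ : f.ker →* FreeGroup ℕ, Function.Surjective φ) := by
  have hA := h.isAmalgam
  have : Nonempty (bassSerreGraph (RAAG.sub_mono h.le₁) (RAAG.sub_mono h.le₂)).V :=
    ⟨leftVertex _ _ ((1 : RAAG Γ) : RAAG Γ ⧸ RAAG.sub Γ₁)⟩
  have hcard : ∀ S : Subgroup (RAAG Γ), ENat.card (MulAction.orbitRel.Quotient f.ker (RAAG Γ ⧸ S)) =
      ENat.card (f.range ⧸ (S.map f).subgroupOf f.range) := fun S =>
    ENat.card_congr (nonempty_orbitRel_quotient_ker_equiv f S).some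
  have hedges : ENat.card (h.kerGraphOfGroups f).E = RAAG.imageIndex f Γ₃ := hcard (RAAG.sub Γ₃)
  refine ⟨⟨RAAG.map_inclusion_injective h.induced₃ h.le₁,
    RAAG.map_inclusion_injective h.induced₃ h.le₂, h.isPushout⟩, hA.isTree,
    OrientedGraph.IsAction.isDecompositionOf _ hA.isPreconnected hA.hasPotentials,
    ⟨leftOrbits f.ker (RAAG.sub_mono h.le₁) (RAAG.sub_mono h.le₂),
      rightOrbits f.ker (RAAG.sub_mono h.le₁) (RAAG.sub_mono h.le₂),
      isCompl_leftOrbits_rightOrbits .., (encard_leftOrbits ..).trans (hcard _),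
      (encard_rightOrbits ..).trans (hcard _), fun v hv => ?_, fun v hv => ?_⟩,
    ⟨hedges, fun e => nonempty_stabilizer_ker_mulEquiv f (RAAG.incl_injective h.induced₃) _⟩,
    fun h₃ => ?_, fun h₃ => ?_⟩
  · obtain ⟨x, hx⟩ := exists_stabilizer_out_eq_of_mem_leftOrbits _ _ _ hv
    exact (nonempty_stabilizer_ker_mulEquiv f (RAAG.incl_injective h.induced₁) x).map
      (MulEquiv.subgroupCongr hx).trans
  · obtain ⟨x, hx⟩ := exists_stabilizer_out_eq_of_mem_rightOrbits _ _ _ hv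
    exact (nonempty_stabilizer_ker_mulEquiv f (RAAG.incl_injective h.induced₂) x).map
      (MulEquiv.subgroupCongr hx).trans
  · have hE : Finite (h.kerGraphOfGroups f).E := by
      obtain ⟨x, hx⟩ : ∃ x, RAAG.restrict f Γ₃ x ≠ 1 := by
        by_contra! hcon
        exact h₃ (MonoidHom.ext hcon)
      have := hf.1
      have : Finite (f.range ⧸ ((RAAG.sub Γ₃).map f).subgroupOf f.range) :=
        finite_quotient_of_isCyclic (s := f.rangeRestrict (RAAG.incl Γ₃ x))
          (Subgroup.mem_subgroupOf.2 ⟨_, ⟨x, rfl⟩, rfl⟩)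
          (fun hcon => hx (congrArg Subtype.val hcon))
      exact Finite.of_equiv _ (nonempty_orbitRel_quotient_ker_equiv f (RAAG.sub Γ₃)).some.symm
    have : Finite (MulAction.orbitRel.Quotient f.ker
        (bassSerreGraph (RAAG.sub_mono h.le₁) (RAAG.sub_mono h.le₂)).E) := hE
    exact ⟨finite_orbits_vertices f.ker (RAAG.sub_mono h.le₁) (RAAG.sub_mono h.le₂), hE⟩
  · obtain ⟨χ, hχ, hne⟩ := hf.exists_int
    have hker : f.ker = χ.ker := by
      ext g
      exact (hχ g).symm
    rw [hker]
    refine h.exists_ker_hom_freeGroup_surjective (fun v hv => ?_) hne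
    have := DFunLike.congr_fun h₃ (RAAG.of Γ₃.coe ⟨v, hv⟩)
    rw [RAAG.restrict, MonoidHom.comp_apply, RAAG.incl_of] at this
    exact (hχ _).2 this
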